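/- Let $L\ge 0$ and $m\ge 0$ be integers and let $N\subset\mathbb C^L$ be an embedded $C^\infty$ submanifold of real dimension $m$ that is totally real ($T_xN\cap iT_xN=\{0\}$ for all $x\in N$) and not generic (it is not the case that $T_xN+iT_xN=\mathbb C^L$ for all $x\in N$). Let $p\in N$ and let $v\in\mathbb C^L$ be complex transversal to $N$ at $p$, that is, $v\notin \operatorname{span}_{\mathbb C}T_pN$. Let $f$ be a continuous complex-valued function on a neighbourhood $N\cap U$ of $p$ in $N$, where $U\ni p$ is open in $\mathbb C^L$. Then there is a wedge $W$ of direction $v$ at $p$ whose edge contains a neighbourhood of $p$ in $N$ and to which $f$ extends holomorphically. That is, there are an open set $V$ with $p\in V\subset U$, a generic embedded $C^\infty$ submanifold $E$ of $\mathbb C^L$ with $N\cap V\subset E$, an open convex cone $\Gamma\subset\mathbb C^L$ with $v\in\Gamma$ and $\Gamma\cap T_pE=\emptyset$, a number $\varepsilon>0$, and a holomorphic function $F$ on the open set $$W=\{x+\gamma:\ x\in E\cap V,\ \gamma\in\Gamma,\ |\gamma|<\varepsilon\}$$ such that $\lim_{W\ni z\to x}F(z)=f(x)$ for every $x\in N\cap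 V$. -/

import Mathlib

open Set Filter Topology
open scoped ContDiff

namespace CRGeom

/-- The complex Euclidean space `ℂ^L`. -/
abbrev CSpace (L : ℕ) : Type := EuclideanSpace ℂ (Fin L)

/-- `N` is an embedded `C^∞` submanifold of `ℂ^L` of real dimension `m` (without boundary, not
necessarily closed): near each of its points there is a real `C^∞` diffeomorphism `e` between open
subsets of `ℂ^L` which carries `N` onto a real linear subspace of dimension `m`. -/
def IsSmoothSubmanifold {L : ℕ} (m : ℕ) (N : Set (CSpace L)) : Prop :=
  ∀ x ∈ N, ∃ (e : OpenPartialHomeomorph (CSpace L) (CSpace L)) (S : Submodule ℝ (CSpace L)),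
    x ∈ e.source ∧ ContDiffOn ℝ ∞ e e.source ∧ ContDiffOn ℝ ∞ e.symm e.target ∧
      Module.finrank ℝ S = m ∧ ∀ z ∈ e.source, z ∈ N ↔ e z ∈ S

/-- The real tangent space `T_x N`: the velocities at `x` of the curves that lie in `N`. For a
submanifold these velocities already form a real vector space, so that the span adds nothing. -/
noncomputable def tangentSpace {L : ℕ} (N : Set (CSpace L)) (x : CSpace L) : Submodule ℝ (CSpace L) :=
  Submodule.span ℝ
    {w | ∃ γ : ℝ → CSpace L, γ 0 = x ∧ (∀ t, γ t ∈ N) ∧ HasDerivAt γ w 0}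

/-- The complex span `T_x N + i T_x N` of the tangent space. -/
noncomputable def complexTangentSpan {L : ℕ} (N : Set (CSpace L)) (x : CSpace L) : Submodule ℂ (CSpace L) :=
  Submodule.span ℂ (tangentSpace N x : Set (CSpace L))

/-- `N` is totally real: `T_x N ∩ i T_x N = 0` at each point `x` of `N`. -/
def IsTotallyReal {L : ℕ} (N : Set (CSpace L)) : Prop :=
  ∀ x ∈ N, ∀ w ∈ tangentSpace N x, Complex.I • w ∈ tangentSpace N x → w = 0

/-- `N` is generic: `T_x N + i T_x N = ℂ^L` at each point `x` of `N`. -/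
def IsGeneric {L : ℕ} (N : Set (CSpace L)) : Prop :=
  ∀ x ∈ N, complexTangentSpan N x = ⊤

/-- `v` is complex transversal to `N` at `p`: it is not in the complex span of `T_p N`. -/
def IsComplexTransversal {L : ℕ} (N : Set (CSpace L)) (p v : CSpace L) : Prop :=
  v ∉ complexTangentSpan N p

/-- `Γ` is an open convex cone of `ℂ^L` about the direction `v`. -/
def IsConicNhd {L : ℕ} (Γ : Set (CSpace L)) (v : CSpace L) : Prop :=
  IsOpen Γ ∧ Convex ℝ Γ ∧ (∀ γ ∈ Γ, ∀ r : ℝ, 0 < r → r • γ ∈ Γ) ∧ v ∈ Γ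

/-- The local wedge `(E ∩ V) + Γ_ε`, where `Γ_ε` is the part of the cone `Γ` of norm less
than `ε`. When `Γ` is open, this is an open set. -/
def wedgeSet {L : ℕ} (E V Γ : Set (CSpace L)) (ε : ℝ) : Set (CSpace L) :=
  {z | ∃ x ∈ E ∩ V, ∃ γ ∈ Γ, ‖γ‖ < ε ∧ z = x + γ}

/-- `W` is a wedge of direction `v` at `p`, with edge the part in `V` of the generic smooth
submanifold `E`: it is `(E ∩ V) + Γ_ε` for some open convex cone `Γ` about `v` that contains no
vector tangent to `E` at `p`. -/
def IsWedge {L : ℕ} (W E V : Set (CSpace L)) (p v : CSpace L) : Prop :=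
  (∃ d : ℕ, IsSmoothSubmanifold d E) ∧ IsGeneric E ∧ p ∈ E ∧ IsOpen V ∧ p ∈ V ∧
    ∃ (Γ : Set (CSpace L)) (ε : ℝ), IsConicNhd Γ v ∧
      Disjoint Γ (tangentSpace E p : Set (CSpace L)) ∧ 0 < ε ∧ W = wedgeSet E V Γ ε

/-- `F` is a holomorphic extension to the (open) set `W` of the function `f` on `A`: it is
holomorphic in `W`, and takes on `A` the boundary values `f`, as limits from all of `W`. -/
def IsHolomorphicExtension {L : ℕ} (F : CSpace L → ℂ) (W : Set (CSpace L)) (f : CSpace L → ℂ)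
    (A : Set (CSpace L)) : Prop :=
  DifferentiableOn ℂ F W ∧ ∀ x ∈ A, Tendsto F (𝓝[W] x) (𝓝 (f x))

end CRGeom

/-!
Let `g : ℝ^m → ℂ^L` parametrize `N` near `p = g 0`. As `N` is totally real and `v` is complex
transversal, there are complex linear coordinates `θ` (with values in `ℂ^m`) and `l` in which `T_p N`
is `ℝ^m ⊂ ℂ^m` and `v` is the next coordinate vector (`exists_adapted_forms`).

The extension is built with Gaussian kernels `exp (-A b(z, s))`, where
`b(z, s) = k Λ_s(z - g s) + ∑ θ_j(z - g s)²` is a quadratic polynomial in `z`, and the complex linear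
form `Λ_s` annihilates `T_{g s} N` and equals `l` on `ker θ` (`exists_annihilating_forms`). By Taylor's
formula, `b(g t, s) = ‖t - s‖²` up to a small relative error if `k`, `t` and `s` are small. Moreover
`Re b` does not decrease if one moves from `g t` first along the real subspace `θ = 0`, `Re l = 0` and
then along a narrow cone about `v`: the gain `k Re l γ` of the linear term absorbs the loss in the
quadratic one (`exists_kernelExponent_bounds`). Hence on the wedge the kernels are dominated by real
Gaussians in `s`.

Integrating the kernels against a continuous function `φ` on `N` therefore gives entire functions that
are bounded on the wedge by a constant times `sup |φ|` and, for large `A`, differ from `φ` on `N` by at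
most half of `sup |φ|` (`norm_gaussianTransform_le`, `norm_gaussianTransform_sub_le`). Applying this to
the successive errors gives a series of entire functions that converges uniformly on the wedge and on
`N`, with sum `φ` on `N` (`exists_extension_of_approximation`).

The edge is `{g t + h : θ h = 0, Re l h = 0}`. It is the image of a real linear subspace under a local
diffeomorphism, and it is generic because its tangent spaces contain those of `N`, the complex
subspace `θ = 0`, `l = 0`, and `i v` (`exists_edge`).
-/

namespace CRGeom

open MeasureTheory Metric

/-! ### Gaussian integrals -/

/-- If `w` is `x` up to a relative error `δ ≤ 1/2`, then `exp (-A w)` and `exp (-A x)` differ by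
`O(δ)`, measured against the wider exponential `exp (-A x / 4)`. -/
theorem norm_cexp_sub_exp_le {A x δ : ℝ} (hA : 0 < A) (hx : 0 ≤ x) (hδ0 : 0 ≤ δ) (hδ : δ ≤ 1 / 2)
    {w : ℂ} (hw : ‖w - x‖ ≤ δ * x) :
    ‖Complex.exp (-A * w) - (Real.exp (-A * x) : ℝ)‖ ≤ 4 * δ * Real.exp (-(A / 2 / 2) * x) := by
  have hδx : δ * x ≤ x / 2 := by nlinarith
  set ρ : ℂ := -A * (w - x) with hρ
  have hρn : ‖ρ‖ ≤ A * (δ * x) := by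
    rw [hρ, norm_mul, norm_neg, Complex.norm_real, Real.norm_of_nonneg hA.le]
    gcongr
  have h1 : Complex.exp (-A * w) - (Real.exp (-A * x) : ℝ)
      = (Real.exp (-A * x) : ℝ) * (Complex.exp ρ - 1) := by
    rw [mul_sub, mul_one, Complex.ofReal_exp, ← Complex.exp_add, hρ]
    congr 2; push_cast; ring
  have h2 : ‖Complex.exp ρ - 1‖ ≤ ‖ρ‖ * Real.exp ‖ρ‖ := by
    simpa using Complex.norm_exp_sub_sum_le_norm_mul_exp ρ 1
  have h0 : 0 ≤ A * (δ * x) := (norm_nonneg _).trans hρn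
  have h3 : A * x / 4 ≤ Real.exp (A * x / 4) := by
    linarith [Real.add_one_le_exp (A * x / 4)]
  rw [h1, norm_mul, Complex.norm_real, Real.norm_of_nonneg (Real.exp_pos _).le]
  calc Real.exp (-A * x) * ‖Complex.exp ρ - 1‖
      ≤ Real.exp (-A * x) * (A * (δ * x) * Real.exp (A * (x / 2))) := by
        gcongr
        refine h2.trans ?_
        gcongr
        exact hρn.trans (by gcongr)
    _ = 4 * δ * (A * x / 4) * Real.exp (-A * x + A * (x / 2)) := by
        rw [Real.exp_add]; ring
    _ ≤ 4 * δ * Real.exp (A * x / 4) * Real.exp (-A * x + A * (x / 2)) := by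
        gcongr
    _ = 4 * δ * Real.exp (-(A / 2 / 2) * x) := by
        rw [mul_assoc, ← Real.exp_add]; congr 2; ring

section Analysis

variable {S : Type*} [NormedAddCommGroup S] [InnerProductSpace ℝ S]

variable (S) in
/-- The total mass `(π / A) ^ (dim S / 2)` of the Gaussian `exp (-A ‖s‖²)` on `S`. -/
noncomputable def gaussianMass (A : ℝ) : ℝ := (Real.pi / A) ^ (Module.finrank ℝ S / 2 : ℝ)

theorem gaussianMass_pos {A : ℝ} (hA : 0 < A) : 0 < gaussianMass S A := by
  unfold gaussianMass; positivity

theorem gaussianMass_half {A : ℝ} (hA : 0 < A) :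
    gaussianMass S (A / 2) = 2 ^ (Module.finrank ℝ S / 2 : ℝ) * gaussianMass S A := by
  unfold gaussianMass
  rw [← Real.mul_rpow (by norm_num) (by positivity)]
  congr 1; field_simp

variable [FiniteDimensional ℝ S] [MeasurableSpace S] [BorelSpace S]

theorem integral_gaussian_sub {A : ℝ} (hA : 0 < A) (t : S) :
    ∫ s : S, Real.exp (-A * ‖t - s‖ ^ 2) = gaussianMass S A := by
  rw [integral_sub_left_eq_self (fun s : S => Real.exp (-A * ‖s‖ ^ 2)) volume t]
  exact GaussianFourier.integral_rexp_neg_mul_sq_norm hA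

theorem integrable_gaussian_sub {A : ℝ} (hA : 0 < A) (t : S) :
    Integrable (fun s : S => Real.exp (-A * ‖t - s‖ ^ 2)) := by
  apply Integrable.of_integral_ne_zero
  rw [integral_gaussian_sub hA]
  exact (gaussianMass_pos hA).ne'

/-! ### The Gaussian transform -/

/-- The superposition `(π / A) ^ (-dim S / 2) ∫_{‖s‖ ≤ R} φ(s) exp (-A b(z, s)) ds`. When
`b(z, s)` is close to `‖t - s‖²` it approximates `φ(t)` for large `A`. -/
noncomputable def gaussianTransform {X : Type*} (b : X → S → ℂ) (R A : ℝ) (φ : S → ℂ) (z : X) : ℂ :=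
  ((gaussianMass S A : ℝ) : ℂ)⁻¹ * ∫ s in closedBall (0 : S) R, φ s * Complex.exp (-A * b z s)

/-- Where the kernel is dominated by a Gaussian, the transform is bounded by the supremum of `φ`,
uniformly in `A`. -/
theorem norm_gaussianTransform_le {X : Type*} {b : X → S → ℂ} {R A M : ℝ} {φ : S → ℂ} {z : X}
    {t : S} (hA : 0 < A) (hM : 0 ≤ M) (hφ : ∀ s ∈ closedBall (0 : S) R, ‖φ s‖ ≤ M)
    (ht : ∀ s ∈ closedBall (0 : S) R, ‖t - s‖ ^ 2 / 2 ≤ (b z s).re) :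
    ‖gaussianTransform b R A φ z‖ ≤ 2 ^ (Module.finrank ℝ S / 2 : ℝ) * M := by
  have hpos := gaussianMass_pos (S := S) hA
  have hint := (integrable_gaussian_sub (S := S) (half_pos hA) t).const_mul M
  have key : ‖∫ s in closedBall (0 : S) R, φ s * Complex.exp (-A * b z s)‖
      ≤ M * gaussianMass S (A / 2) := by
    rw [← integral_gaussian_sub (half_pos hA) t, ← integral_const_mul]
    refine (norm_integral_le_of_norm_le hint.integrableOn ?_).trans
      (setIntegral_le_integral hint (Eventually.of_forall fun s => by positivity))
    refine (ae_restrict_mem measurableSet_closedBall).mono fun s hs => ?_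
    rw [norm_mul, Complex.norm_exp]
    have := ht s hs
    have h2 : (-(A : ℂ) * b z s).re ≤ -(A / 2) * ‖t - s‖ ^ 2 := by
      rw [← Complex.ofReal_neg, Complex.re_ofReal_mul]
      nlinarith
    gcongr
    exact hφ s hs
  rw [gaussianTransform, norm_mul, norm_inv, Complex.norm_real, Real.norm_of_nonneg hpos.le,
    inv_mul_le_iff₀ hpos]
  refine key.trans (le_of_eq ?_)
  rw [gaussianMass_half hA]; ring

/-- The transform approximates `φ(t)` where the exponent is `‖t - s‖²` up to a relative error `δ`.
The three error terms come from `δ`, from the oscillation `τ` of `φ` on the ball of radius `η` about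
`t`, and from the mass of the Gaussian outside this ball. -/
theorem norm_gaussianTransform_sub_le {X : Type*} {b : X → S → ℂ} {R A M δ η τ : ℝ} {φ : S → ℂ}
    {z : X} {t : S} (hA : 0 < A) (hM : 0 ≤ M) (hη : 0 < η) (hτ : 0 ≤ τ) (hδ0 : 0 ≤ δ)
    (hδ : δ ≤ 1 / 2) (hφc : ContinuousOn φ (closedBall (0 : S) R))
    (hbc : ContinuousOn (b z) (closedBall (0 : S) R))
    (hφ : ∀ s ∈ closedBall (0 : S) R, ‖φ s‖ ≤ M) (htη : ball t η ⊆ closedBall (0 : S) R)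
    (hosc : ∀ s ∈ ball t η, ‖φ s - φ t‖ ≤ τ)
    (hb : ∀ s ∈ closedBall (0 : S) R, ‖b z s - (‖t - s‖ ^ 2 : ℝ)‖ ≤ δ * ‖t - s‖ ^ 2) :
    ‖gaussianTransform b R A φ z - φ t‖ ≤
      M * (4 * δ) * (2 ^ (Module.finrank ℝ S / 2 : ℝ) * 2 ^ (Module.finrank ℝ S / 2 : ℝ)) + τ
        + 2 * M / η ^ 2 * (2 / A) * 2 ^ (Module.finrank ℝ S / 2 : ℝ) := by
  classical
  have hpos := gaussianMass_pos (S := S) hA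
  have htM : ‖φ t‖ ≤ M := hφ t (htη (mem_ball_self hη))
  set B := closedBall (0 : S) R with hB
  set g : S → ℝ := fun s => Real.exp (-A * ‖t - s‖ ^ 2) with hg
  have hgi : Integrable g := integrable_gaussian_sub hA t
  set u : S → ℂ := B.indicator fun s => φ s * Complex.exp (-A * b z s) with hu
  have hui : Integrable u := by
    rw [hu, integrable_indicator_iff measurableSet_closedBall]
    exact ContinuousOn.integrableOn_compact (isCompact_closedBall _ _)
      (hφc.mul (Complex.continuous_exp.comp_continuousOn (continuousOn_const.mul hbc)))
  have hvi : Integrable fun s => φ t * ((g s : ℝ) : ℂ) := hgi.ofReal.const_mul _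
  have hG : (gaussianTransform b R A φ z - φ t) * ((gaussianMass S A : ℝ) : ℂ)
      = ∫ s, (u s - φ t * ((g s : ℝ) : ℂ)) := by
    rw [integral_sub hui hvi, hu, integral_indicator measurableSet_closedBall, integral_const_mul,
      integral_complex_ofReal, hg, integral_gaussian_sub hA, gaussianTransform, sub_mul]
    congr 1
    have : ((gaussianMass S A : ℝ) : ℂ) ≠ 0 := by exact_mod_cast hpos.ne'
    field_simp
  have h4 := (integrable_gaussian_sub (S := S) (half_pos (half_pos hA)) t).const_mul (M * (4 * δ))
  have h2 := (integrable_gaussian_sub (S := S) (half_pos hA) t).const_mul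
    (2 * M / η ^ 2 * (2 / A))
  have h1 := hgi.const_mul τ
  have hpt : ∀ s, ‖u s - φ t * ((g s : ℝ) : ℂ)‖ ≤
      M * (4 * δ) * Real.exp (-(A / 2 / 2) * ‖t - s‖ ^ 2) + τ * g s
        + 2 * M / η ^ 2 * (2 / A) * Real.exp (-(A / 2) * ‖t - s‖ ^ 2) := by
    intro s
    have hgs : 0 < g s := Real.exp_pos _
    have hfar : s ∉ ball t η →
        2 * M * g s ≤ 2 * M / η ^ 2 * (2 / A) * Real.exp (-(A / 2) * ‖t - s‖ ^ 2) := by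
      intro hs
      rw [mem_ball, dist_comm, dist_eq_norm, not_lt] at hs
      have hx : η ^ 2 ≤ ‖t - s‖ ^ 2 := by gcongr
      have he : A / 2 * ‖t - s‖ ^ 2 ≤ Real.exp (A / 2 * ‖t - s‖ ^ 2) := by
        linarith [Real.add_one_le_exp (A / 2 * ‖t - s‖ ^ 2)]
      have he' : 1 ≤ (2 / A) / η ^ 2 * Real.exp (A / 2 * ‖t - s‖ ^ 2) := by
        calc (1 : ℝ) = (2 / A) / η ^ 2 * (A / 2 * η ^ 2) := by field_simp
          _ ≤ (2 / A) / η ^ 2 * Real.exp (A / 2 * ‖t - s‖ ^ 2) := by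
            gcongr
            exact le_trans (by gcongr) he
      calc 2 * M * g s = 2 * M * g s * 1 := by ring
        _ ≤ 2 * M * g s * ((2 / A) / η ^ 2 * Real.exp (A / 2 * ‖t - s‖ ^ 2)) := by gcongr
        _ = 2 * M / η ^ 2 * (2 / A) * (g s * Real.exp (A / 2 * ‖t - s‖ ^ 2)) := by ring
        _ = 2 * M / η ^ 2 * (2 / A) * Real.exp (-(A / 2) * ‖t - s‖ ^ 2) := by
          rw [hg, ← Real.exp_add]; congr 2; ring
    have hosc' : s ∈ B → ‖φ s - φ t‖ * g s ≤ τ * g s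
        + 2 * M / η ^ 2 * (2 / A) * Real.exp (-(A / 2) * ‖t - s‖ ^ 2) := by
      intro hsB
      by_cases hs : s ∈ ball t η
      · have := hosc s hs
        have : ‖φ s - φ t‖ * g s ≤ τ * g s := by gcongr
        have : 0 ≤ 2 * M / η ^ 2 * (2 / A) * Real.exp (-(A / 2) * ‖t - s‖ ^ 2) := by positivity
        linarith
      · have h3 := hfar hs
        have : ‖φ s - φ t‖ ≤ 2 * M := (norm_sub_le _ _).trans (by linarith [hφ s hsB])
        have : ‖φ s - φ t‖ * g s ≤ 2 * M * g s := by gcongr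
        have : 0 ≤ τ * g s := by positivity
        linarith
    by_cases hsB : s ∈ B
    · have e1 : u s - φ t * ((g s : ℝ) : ℂ)
          = φ s * (Complex.exp (-A * b z s) - ((g s : ℝ) : ℂ)) + (φ s - φ t) * ((g s : ℝ) : ℂ) := by
        rw [hu, indicator_of_mem hsB]; ring
      rw [e1]
      refine (norm_add_le _ _).trans ?_
      rw [norm_mul, norm_mul, Complex.norm_real, Real.norm_of_nonneg hgs.le, add_assoc]
      refine add_le_add ?_ (hosc' hsB)
      rw [mul_assoc M]
      exact mul_le_mul (hφ s hsB)
        (norm_cexp_sub_exp_le hA (by positivity) hδ0 hδ (hb s hsB)) (norm_nonneg _) hM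
    · have hs : s ∉ ball t η := fun h => hsB (htη h)
      rw [hu, indicator_of_notMem hsB, zero_sub, norm_neg, norm_mul, Complex.norm_real,
        Real.norm_of_nonneg hgs.le]
      have h3 := hfar hs
      have h5 : ‖φ t‖ * g s ≤ M * g s := by gcongr
      have h6 : 0 ≤ M * g s := by positivity
      have h7 : 0 ≤ M * (4 * δ) * Real.exp (-(A / 2 / 2) * ‖t - s‖ ^ 2) := by positivity
      have h8 : 0 ≤ τ * g s := by positivity
      linarith
  have h41 : Integrable fun s : S =>
      M * (4 * δ) * Real.exp (-(A / 2 / 2) * ‖t - s‖ ^ 2) + τ * g s := h4.add h1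
  have hle := norm_integral_le_of_norm_le (h41.add h2) (Eventually.of_forall hpt)
  rw [← hG, norm_mul, Complex.norm_real, Real.norm_of_nonneg hpos.le] at hle
  simp only [Pi.add_apply] at hle
  rw [integral_add h41 h2, integral_add h4 h1, integral_const_mul, integral_const_mul,
    integral_const_mul, hg, integral_gaussian_sub hA, integral_gaussian_sub (half_pos hA),
    integral_gaussian_sub (half_pos (half_pos hA)), gaussianMass_half (half_pos hA),
    gaussianMass_half hA] at hle
  refine le_of_mul_le_mul_right (hle.trans (le_of_eq ?_)) hpos
  ring

theorem differentiable_gaussianTransform {X : Type*} [NormedAddCommGroup X] [NormedSpace ℂ X]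
    [ProperSpace X] {b : X → S → ℂ} {b' : X → S → X →L[ℂ] ℂ} {R A : ℝ} {φ : S → ℂ}
    (hφc : ContinuousOn φ (closedBall (0 : S) R))
    (hbc : ContinuousOn (Function.uncurry b) (univ ×ˢ closedBall (0 : S) R))
    (hbc' : ContinuousOn (Function.uncurry b') (univ ×ˢ closedBall (0 : S) R))
    (hb : ∀ z, ∀ s ∈ closedBall (0 : S) R, HasFDerivAt (fun z => b z s) (b' z s) z) :
    Differentiable ℂ (gaussianTransform b R A φ) := by
  set B := closedBall (0 : S) R with hB
  have hBc : IsCompact B := isCompact_closedBall _ _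
  refine Differentiable.const_mul (fun z₀ => ?_) _
  set F : X → S → ℂ := fun z s => φ s * Complex.exp (-A * b z s) with hF
  set F' : X → S → X →L[ℂ] ℂ := fun z s => (φ s * (Complex.exp (-A * b z s) * (-A))) • b' z s
    with hF'
  have hφ2 : ContinuousOn (fun q : X × S => φ q.2) (univ ×ˢ B) :=
    hφc.comp continuousOn_snd fun q hq => hq.2
  have hE : ContinuousOn (fun q : X × S => Complex.exp (-A * b q.1 q.2)) (univ ×ˢ B) :=
    Complex.continuous_exp.comp_continuousOn (continuousOn_const.mul hbc)
  have hFc : ContinuousOn (Function.uncurry F) (univ ×ˢ B) := hφ2.mul hE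
  have hFc' : ContinuousOn (Function.uncurry F') (univ ×ˢ B) :=
    (hφ2.mul (hE.mul continuousOn_const)).smul hbc'
  have hsl : ∀ z : X, ContinuousOn (fun s : S => (z, s)) B := fun z => by fun_prop
  have hFz : ∀ z, ContinuousOn (F z) B := fun z =>
    hFc.comp (hsl z) fun s hs => ⟨mem_univ _, hs⟩
  have hFz' : ∀ z, ContinuousOn (F' z) B := fun z =>
    hFc'.comp (hsl z) fun s hs => ⟨mem_univ _, hs⟩
  obtain ⟨C, hC⟩ := ((isCompact_closedBall z₀ 1).prod hBc).exists_bound_of_continuousOn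
    (hFc'.mono (prod_mono (subset_univ _) subset_rfl))
  refine (hasFDerivAt_integral_of_dominated_of_fderiv_le (μ := volume.restrict B) (F := F)
    (F' := F') (bound := fun _ => C) (closedBall_mem_nhds z₀ one_pos)
    (Eventually.of_forall fun z => ((hFz z).integrableOn_compact hBc).aestronglyMeasurable)
    ((hFz z₀).integrableOn_compact hBc)
    ((hFz' z₀).integrableOn_compact hBc).aestronglyMeasurable ?_
    (continuousOn_const.integrableOn_compact hBc) ?_).differentiableAt
  · exact (ae_restrict_mem measurableSet_closedBall).mono fun s hs z hz => hC (z, s) ⟨hz, hs⟩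
  · refine (ae_restrict_mem measurableSet_closedBall).mono fun s hs z hz => ?_
    have h := (((hb z s hs).const_mul (-(A : ℂ))).cexp).const_mul (φ s)
    rw [smul_smul, smul_smul, mul_assoc] at h
    exact h

end Analysis

/-! ### Interpolation by successive approximation -/

/-- Cauchy's estimate for the derivative of an entire function of several variables. -/
theorem norm_fderiv_le_of_forall_mem_closedBall {X : Type*} [NormedAddCommGroup X]
    [NormedSpace ℂ X] {G : X → ℂ} (hG : Differentiable ℂ G) {z : X} {ρ M : ℝ} (hρ : 0 < ρ)
    (hM : ∀ y ∈ closedBall z ρ, ‖G y‖ ≤ M) : ‖fderiv ℂ G z‖ ≤ M / ρ := by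
  have hM0 : 0 ≤ M := (norm_nonneg _).trans (hM z (mem_closedBall_self hρ.le))
  refine ContinuousLinearMap.opNorm_le_bound _ (by positivity) fun u => ?_
  rcases eq_or_ne u 0 with rfl | hu
  · simp
  have hu' : 0 < ‖u‖ := norm_pos_iff.2 hu
  have hl : ∀ c : ℂ, HasDerivAt (fun c : ℂ => z + c • u) u c := fun c => by
    simpa using ((hasDerivAt_id c).smul_const u).const_add z
  have hd : HasDerivAt (fun c : ℂ => G (z + c • u)) (fderiv ℂ G z u) 0 := by
    have h1 : HasFDerivAt G (fderiv ℂ G z) (z + (0 : ℂ) • u) := by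
      simpa using (hG z).hasFDerivAt
    exact h1.comp_hasDerivAt (0 : ℂ) (hl 0)
  have hdiff : Differentiable ℂ fun c : ℂ => G (z + c • u) :=
    hG.comp fun c => (hl c).differentiableAt
  rw [← hd.deriv]
  refine (Complex.norm_deriv_le_of_forall_mem_sphere_norm_le (div_pos hρ hu')
    hdiff.diffContOnCl fun c hc => hM _ ?_).trans (le_of_eq ?_)
  · rw [mem_closedBall, dist_eq_norm, add_sub_cancel_left, norm_smul]
    rw [mem_sphere, dist_zero_right] at hc
    rw [hc, div_mul_cancel₀ _ hu'.ne']
  · field_simp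

/-- If every continuous function on `n(B)` can be approximated up to half its size by an entire
function whose size on `D` is controlled, then every continuous function on `n(B)` extends to a
continuous function on `D` that is holomorphic in the interior: correct the error repeatedly and
sum the geometric series. -/
theorem exists_extension_of_approximation {X S : Type*} [NormedAddCommGroup X] [NormedSpace ℂ X]
    [TopologicalSpace S] {B : Set S} {n : S → X} {D : Set X} {C : ℝ}
    (hn : ContinuousOn n B) (hnD : ∀ t ∈ B, n t ∈ D)
    (approx : ∀ M : ℝ, 0 < M → ∀ φ : S → ℂ, ContinuousOn φ B → (∀ t ∈ B, ‖φ t‖ ≤ M) →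
      ∃ G : X → ℂ, Differentiable ℂ G ∧ (∀ z ∈ D, ‖G z‖ ≤ C * M) ∧
        ∀ t ∈ B, ‖φ t - G (n t)‖ ≤ M / 2)
    (hB : IsCompact B) {φ : S → ℂ} (hφ : ContinuousOn φ B) :
    ∃ F : X → ℂ, ContinuousOn F D ∧ DifferentiableOn ℂ F (interior D) ∧
      ∀ t ∈ B, F (n t) = φ t := by
  obtain ⟨M₀, hM₀⟩ := hB.exists_bound_of_continuousOn hφ
  set M : ℝ := max M₀ 1 with hMdef
  have hM : 0 < M := lt_max_of_lt_right one_pos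
  have hex : ∀ (k : ℕ) (ψ : S → ℂ), ∃ G : X → ℂ,
      ContinuousOn ψ B → (∀ t ∈ B, ‖ψ t‖ ≤ M * (1 / 2) ^ k) →
      Differentiable ℂ G ∧ (∀ z ∈ D, ‖G z‖ ≤ C * (M * (1 / 2) ^ k)) ∧
        ∀ t ∈ B, ‖ψ t - G (n t)‖ ≤ M * (1 / 2) ^ k / 2 := by
    intro k ψ
    by_cases h : ContinuousOn ψ B ∧ ∀ t ∈ B, ‖ψ t‖ ≤ M * (1 / 2) ^ k
    · obtain ⟨G, hG⟩ := approx (M * (1 / 2) ^ k) (by positivity) ψ h.1 h.2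
      exact ⟨G, fun _ _ => hG⟩
    · exact ⟨0, fun h1 h2 => absurd ⟨h1, h2⟩ h⟩
  choose Γ hΓ using hex
  let ψ : ℕ → S → ℂ := fun k => Nat.rec φ (fun k ψ t => ψ t - Γ k ψ (n t)) k
  have hψs : ∀ k t, ψ (k + 1) t = ψ k t - Γ k (ψ k) (n t) := fun k t => rfl
  have hψ : ∀ k, ContinuousOn (ψ k) B ∧ ∀ t ∈ B, ‖ψ k t‖ ≤ M * (1 / 2) ^ k := by
    intro k
    induction k with
    | zero =>
      refine ⟨hφ, fun t ht => ?_⟩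
      rw [pow_zero, mul_one]
      exact (hM₀ t ht).trans (le_max_left _ _)
    | succ k ih =>
      obtain ⟨h1, -, h3⟩ := hΓ k (ψ k) ih.1 ih.2
      refine ⟨ih.1.sub (h1.continuous.comp_continuousOn hn), fun t ht => ?_⟩
      rw [hψs]
      refine (h3 t ht).trans (le_of_eq ?_)
      rw [pow_succ]; ring
  set G : ℕ → X → ℂ := fun k => Γ k (ψ k) with hGdef
  have hGd : ∀ k, Differentiable ℂ (G k) := fun k => (hΓ k _ (hψ k).1 (hψ k).2).1
  have hGb : ∀ k, ∀ z ∈ D, ‖G k z‖ ≤ C * M * (1 / 2) ^ k := fun k z hz => by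
    rw [mul_assoc]; exact (hΓ k _ (hψ k).1 (hψ k).2).2.1 z hz
  have hsum : Summable fun k : ℕ => C * M * (1 / 2 : ℝ) ^ k := summable_geometric_two.mul_left _
  have hpart : ∀ k t, ∑ j ∈ Finset.range k, G j (n t) = φ t - ψ k t := by
    intro k t
    induction k with
    | zero => simp [ψ]
    | succ k ih => rw [Finset.sum_range_succ, ih, hψs]; ring
  refine ⟨fun z => ∑' k, G k z, continuousOn_tsum (fun k => (hGd k).continuous.continuousOn) hsum
    hGb, fun z hz => ?_, fun t ht => ?_⟩
  · obtain ⟨ρ, hρ, hball⟩ := Metric.isOpen_iff.1 isOpen_interior z hz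
    have hρ2 : 0 < ρ / 2 := half_pos hρ
    have hsub : ∀ y ∈ ball z (ρ / 2), closedBall y (ρ / 4) ⊆ D := fun y hy x hx => by
      refine interior_subset (hball ?_)
      rw [mem_ball] at hy ⊢
      rw [mem_closedBall] at hx
      linarith [dist_triangle x y z]
    have hder : HasFDerivAt (fun y => ∑' k, G k y) (∑' k, fderiv ℂ (G k) z) z :=
      hasFDerivAt_tsum_of_isPreconnected (hsum.div_const (ρ / 4)) isOpen_ball
        (convex_ball z (ρ / 2)).isPreconnected
        (fun k y _ => (hGd k y).hasFDerivAt)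
        (fun k y hy => norm_fderiv_le_of_forall_mem_closedBall (hGd k) (by positivity)
          fun x hx => hGb k x (hsub y hy hx))
        (mem_ball_self hρ2)
        (Summable.of_norm_bounded hsum fun k => hGb k z (interior_subset hz))
        (mem_ball_self hρ2)
    exact hder.differentiableAt.differentiableWithinAt
  · have hs : HasSum (fun k => G k (n t)) (∑' k, G k (n t)) :=
      (Summable.of_norm_bounded hsum fun k => hGb k _ (hnD t ht)).hasSum
    have hlim : Tendsto (fun k => ψ k t) atTop (𝓝 0) := by
      refine squeeze_zero_norm (fun k => (hψ k).2 t ht) ?_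
      simpa using (tendsto_pow_atTop_nhds_zero_of_lt_one (by norm_num : (0 : ℝ) ≤ 1 / 2)
        (by norm_num)).const_mul M
    refine tendsto_nhds_unique hs.tendsto_sum_nat ?_
    simp only [hpart]
    simpa using (tendsto_const_nhds (x := φ t)).sub hlim

/-- The region where `exp (-A b(z, ·))` is dominated by a Gaussian centred in the ball of
radius `r`. -/
def dominationRegion {X S : Type*} [NormedAddCommGroup S] (b : X → S → ℂ) (r : ℝ) : Set X :=
  {z | ∃ t ∈ closedBall (0 : S) r, ∀ s ∈ closedBall (0 : S) (2 * r), ‖t - s‖ ^ 2 / 2 ≤ (b z s).re}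

variable {S : Type*} [NormedAddCommGroup S] [InnerProductSpace ℝ S] [FiniteDimensional ℝ S]

/-- Given a kernel exponent `b(z, s)`, holomorphic in `z`, that on the submanifold `n` is
`‖t - s‖²` up to a small relative error, continuous functions on the submanifold extend
holomorphically to the region where the kernel is dominated by Gaussians. -/
theorem exists_extension_of_kernel {X : Type*} [NormedAddCommGroup X]
    [NormedSpace ℂ X] [ProperSpace X] {b : X → S → ℂ} {b' : X → S → X →L[ℂ] ℂ} {r δ : ℝ}
    {n : S → X} (hr : 0 < r) (hδ0 : 0 ≤ δ)
    (hδ : δ * (16 * (2 ^ (Module.finrank ℝ S / 2 : ℝ) * 2 ^ (Module.finrank ℝ S / 2 : ℝ))) ≤ 1)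
    (hbc : ContinuousOn (Function.uncurry b) (univ ×ˢ closedBall (0 : S) (2 * r)))
    (hbc' : ContinuousOn (Function.uncurry b') (univ ×ˢ closedBall (0 : S) (2 * r)))
    (hb : ∀ z, ∀ s ∈ closedBall (0 : S) (2 * r), HasFDerivAt (fun z => b z s) (b' z s) z)
    (hn : ContinuousOn n (closedBall 0 r))
    (hbn : ∀ t ∈ closedBall (0 : S) r, ∀ s ∈ closedBall (0 : S) (2 * r),
      ‖b (n t) s - (‖t - s‖ ^ 2 : ℝ)‖ ≤ δ * ‖t - s‖ ^ 2)
    {φ : S → ℂ} (hφ : ContinuousOn φ (closedBall 0 r)) :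
    ∃ F : X → ℂ, ContinuousOn F (dominationRegion b r) ∧
      DifferentiableOn ℂ F (interior (dominationRegion b r)) ∧
      ∀ t ∈ closedBall (0 : S) r, F (n t) = φ t := by
  borelize S
  set q : ℝ := 2 ^ (Module.finrank ℝ S / 2 : ℝ) with hq
  have hq1 : 1 ≤ q := Real.one_le_rpow (by norm_num) (by positivity)
  have hq0 : 0 < q := by linarith
  have hδ2 : δ ≤ 1 / 2 := by
    have : δ * 16 ≤ δ * (16 * (q * q)) := by gcongr; nlinarith
    linarith
  have hnD : ∀ t ∈ closedBall (0 : S) r, n t ∈ dominationRegion b r := by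
    refine fun t ht => ⟨t, ht, fun s hs => ?_⟩
    have h := (Complex.abs_re_le_norm _).trans (hbn t ht s hs)
    rw [Complex.sub_re, Complex.ofReal_re] at h
    have h1 := (abs_le.1 h).1
    have : δ * ‖t - s‖ ^ 2 ≤ 1 / 2 * ‖t - s‖ ^ 2 := by gcongr
    linarith
  refine exists_extension_of_approximation (C := q) hn hnD ?_ (isCompact_closedBall _ _) hφ
  intro M hM φ hφ hφM
  -- The radial retraction onto the ball extends `φ` beyond the ball with the same bound.
  set ret : S → S := fun s => (r / max r ‖s‖) • s with hret
  have hmax : ∀ s : S, 0 < max r ‖s‖ := fun s => lt_max_of_lt_left hr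
  have hretc : Continuous ret :=
    (continuous_const.div (continuous_const.max continuous_norm) fun s => (hmax s).ne').smul
      continuous_id
  have hretm : ∀ s, ret s ∈ closedBall (0 : S) r := fun s => by
    rw [mem_closedBall, dist_zero_right, hret, norm_smul, Real.norm_of_nonneg
      (div_nonneg hr.le (hmax s).le), div_mul_eq_mul_div, div_le_iff₀ (hmax s)]
    gcongr
    exact le_max_right _ _
  have hreteq : ∀ s ∈ closedBall (0 : S) r, ret s = s := fun s hs => by
    rw [mem_closedBall, dist_zero_right] at hs
    rw [hret]; simp only [max_eq_left hs, div_self hr.ne', one_smul]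
  set ψ : S → ℂ := fun s => φ (ret s) with hψ
  have hψc : Continuous ψ := hφ.comp_continuous hretc hretm
  have hψM : ∀ s, ‖ψ s‖ ≤ M := fun s => hφM _ (hretm s)
  have huc : UniformContinuousOn ψ (closedBall (0 : S) (2 * r)) :=
    (isCompact_closedBall _ _).uniformContinuousOn_of_continuous hψc.continuousOn
  obtain ⟨η₀, hη₀, hη₀'⟩ := Metric.uniformContinuousOn_iff_le.1 huc (M / 8) (by positivity)
  set η := min η₀ r with hη
  have hηpos : 0 < η := lt_min hη₀ hr
  -- With this `A` the contribution of the parameters at distance at least `η` is `M / 8`.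
  set A : ℝ := 2 * 16 * q / η ^ 2 with hAdef
  have hA : 0 < A := by positivity
  refine ⟨gaussianTransform b (2 * r) A ψ,
    differentiable_gaussianTransform hψc.continuousOn hbc hbc' hb, ?_, fun t ht => ?_⟩
  · rintro z ⟨t, -, hz⟩
    exact norm_gaussianTransform_le hA hM.le (fun s _ => hψM s) hz
  · have hball : ball t η ⊆ closedBall (0 : S) (2 * r) := fun s hs => by
      rw [mem_closedBall] at ht ⊢
      have h1 : dist s t < r := (mem_ball.1 hs).trans_le (min_le_right _ _)
      linarith [dist_triangle s t 0]
    have ht2 : t ∈ closedBall (0 : S) (2 * r) := hball (mem_ball_self hηpos)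
    have hbz : ContinuousOn (b (n t)) (closedBall (0 : S) (2 * r)) :=
      hbc.comp (f := fun s : S => (n t, s)) (by fun_prop) fun s hs => ⟨mem_univ _, hs⟩
    have h := norm_gaussianTransform_sub_le (φ := ψ) hA hM.le hηpos
      (by positivity : 0 ≤ M / 8) hδ0 hδ2 hψc.continuousOn hbz (fun s _ => hψM s) hball
      (fun s hs => by
        rw [← dist_eq_norm]
        exact hη₀' s (hball hs) t ht2 ((mem_ball.1 hs).le.trans (min_le_left _ _)))
      (hbn t ht)
    have hψt : ψ t = φ t := by rw [hψ]; simp only [hreteq t ht]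
    rw [hψt, ← hq] at h
    rw [norm_sub_rev]
    refine h.trans ?_
    have e1 : M * (4 * δ) * (q * q) ≤ M / 4 := by
      have : M * (δ * (16 * (q * q))) ≤ M * 1 := by gcongr
      linarith
    have e2 : 2 * M / η ^ 2 * (2 / A) * q = M / 8 := by
      rw [hAdef]; field_simp; norm_num
    linarith

/-! ### The holomorphic kernel exponent along a parametrized totally real submanifold -/

theorem norm_sum_add_sq_sub_le {ι : Type*} [Fintype ι] {a w : ι → ℂ} {α β : ℝ}
    (ha : ∀ j, ‖a j‖ ≤ α) (hw : ∀ j, ‖w j‖ ≤ β) :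
    ‖∑ j, (a j + w j) ^ 2 - ∑ j, a j ^ 2‖ ≤ Fintype.card ι * ((2 * α + β) * β) := by
  rw [← Finset.sum_sub_distrib]
  refine (norm_sum_le_of_le Finset.univ (f := fun j => (a j + w j) ^ 2 - a j ^ 2)
    (n := fun _ => (2 * α + β) * β) fun j _ => ?_).trans (by simp)
  have e : (a j + w j) ^ 2 - a j ^ 2 = (2 * a j + w j) * w j := by ring
  have h0 : 0 ≤ β := (norm_nonneg _).trans (hw j)
  have h1 : ‖2 * a j + w j‖ ≤ 2 * α + β := by
    refine (norm_add_le _ _).trans (add_le_add ?_ (hw j))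
    rw [norm_mul, Complex.norm_ofNat]
    linarith [ha j]
  rw [e, norm_mul]
  exact mul_le_mul h1 (hw j) (norm_nonneg _) ((norm_nonneg _).trans h1)

/-- Second order Taylor estimate with constants uniform near the origin. -/
theorem exists_taylor_bound {V X : Type*} [NormedAddCommGroup V] [NormedSpace ℝ V]
    [NormedAddCommGroup X] [NormedSpace ℝ X] {g : V → X} {O : Set V} (hO : IsOpen O)
    (h0 : (0 : V) ∈ O) (hg : ContDiffOn ℝ ∞ g O) :
    ∃ K : ℝ, 0 ≤ K ∧ ∃ ρ > 0, ball 0 ρ ⊆ O ∧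
      (∀ s ∈ ball (0 : V) ρ, ‖fderiv ℝ g s - fderiv ℝ g 0‖ ≤ K * ‖s‖) ∧
      ∀ s ∈ ball (0 : V) ρ, ∀ t ∈ ball (0 : V) ρ,
        ‖g t - g s - fderiv ℝ g s (t - s)‖ ≤ K * ‖t - s‖ ^ 2 := by
  have hd : ContDiffAt ℝ 1 (fderiv ℝ g) 0 :=
    (hg.contDiffAt (hO.mem_nhds h0)).fderiv_right (m := 1) (by norm_cast)
  obtain ⟨K, T, hT, hK⟩ := hd.exists_lipschitzOnWith
  obtain ⟨ρ, hρ, hsub⟩ := Metric.mem_nhds_iff.1 (inter_mem hT (hO.mem_nhds h0))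
  refine ⟨K, K.2, ρ, hρ, fun x hx => (hsub hx).2, fun s hs => ?_, fun s hs t ht => ?_⟩
  · simpa [dist_eq_norm] using
      hK.dist_le_mul s (hsub hs).1 0 (hsub (mem_ball_self hρ)).1
  · have hseg : segment ℝ s t ⊆ ball (0 : V) ρ := (convex_ball 0 ρ).segment_subset hs ht
    have hder : ∀ x ∈ segment ℝ s t, HasFDerivWithinAt g (fderiv ℝ g x) (segment ℝ s t) x :=
      fun x hx => (((hg.contDiffAt (hO.mem_nhds (hsub (hseg hx)).2)).differentiableAt
        (by norm_num)).hasFDerivAt).hasFDerivWithinAt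
    have hbd : ∀ x ∈ segment ℝ s t, ‖fderiv ℝ g x - fderiv ℝ g s‖ ≤ K * ‖t - s‖ := by
      intro x hx
      rw [← dist_eq_norm]
      refine (hK.dist_le_mul x (hsub (hseg hx)).1 s (hsub hs).1).trans ?_
      gcongr
      rw [dist_eq_norm]
      exact norm_sub_le_of_mem_segment hx
    refine (Convex.norm_image_sub_le_of_norm_hasFDerivWithin_le' hder hbd
      (convex_segment s t) (left_mem_segment ℝ s t) (right_mem_segment ℝ s t)).trans
      (le_of_eq (by ring))

section Frame

variable {L m : ℕ}

/-- The complex linear endomorphism of `ℂ^L` that fixes `ker θ` and carries the frame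
`g'(0) e_j`, which is dual to `θ`, to the frame `g'(s) e_j`. -/
noncomputable def frameShift (g : EuclideanSpace ℝ (Fin m) → CSpace L)
    (θ : CSpace L →L[ℂ] (Fin m → ℂ)) (s : EuclideanSpace ℝ (Fin m)) : CSpace L →L[ℂ] CSpace L :=
  1 + ∑ j, ((ContinuousLinearMap.proj j).comp θ).smulRight
    (fderiv ℝ g s (EuclideanSpace.single j 1) - fderiv ℝ g 0 (EuclideanSpace.single j 1))

variable {g : EuclideanSpace ℝ (Fin m) → CSpace L} {θ : CSpace L →L[ℂ] (Fin m → ℂ)}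

theorem frameShift_apply (s : EuclideanSpace ℝ (Fin m)) (z : CSpace L) :
    frameShift g θ s z = z + ∑ j, θ z j •
      (fderiv ℝ g s (EuclideanSpace.single j 1) - fderiv ℝ g 0 (EuclideanSpace.single j 1)) := by
  simp [frameShift]

theorem frameShift_zero : frameShift g θ 0 = 1 := by
  simp [frameShift]

theorem frameShift_of_ker (s : EuclideanSpace ℝ (Fin m)) {h : CSpace L} (hh : θ h = 0) :
    frameShift g θ s h = h := by
  simp [frameShift_apply, hh]

theorem sum_coord_smul_apply_single (T : EuclideanSpace ℝ (Fin m) →L[ℝ] CSpace L)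
    (u : EuclideanSpace ℝ (Fin m)) :
    ∑ j, ((u j : ℝ) : ℂ) • T (EuclideanSpace.single j 1) = T u := by
  have hu : u = ∑ j, u j • (EuclideanSpace.single j 1 : EuclideanSpace ℝ (Fin m)) := by
    ext i
    simp [Finset.sum_apply, Pi.single_apply]
  conv_rhs => rw [hu, map_sum]
  refine Finset.sum_congr rfl fun j _ => ?_
  rw [map_smul, Complex.coe_smul]

theorem frameShift_fderiv_zero (hθ : ∀ u j, θ (fderiv ℝ g 0 u) j = ((u j : ℝ) : ℂ))
    (s u : EuclideanSpace ℝ (Fin m)) :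
    frameShift g θ s (fderiv ℝ g 0 u) = fderiv ℝ g s u := by
  simp only [frameShift_apply, hθ, smul_sub, Finset.sum_sub_distrib, sum_coord_smul_apply_single]
  abel

theorem continuousAt_frameShift {O : Set (EuclideanSpace ℝ (Fin m))} (hO : IsOpen O)
    (hg : ContDiffOn ℝ ∞ g O) {s : EuclideanSpace ℝ (Fin m)} (hs : s ∈ O) :
    ContinuousAt (frameShift g θ) s := by
  have hd : ContinuousAt (fderiv ℝ g) s :=
    ((hg.contDiffAt (hO.mem_nhds hs)).fderiv_right (m := 0) (by norm_cast)).continuousAt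
  unfold frameShift
  refine continuousAt_const.add (tendsto_finsetSum _ fun j _ => ?_)
  have h1 : ContinuousAt (fun x => fderiv ℝ g x (EuclideanSpace.single j 1)
      - fderiv ℝ g 0 (EuclideanSpace.single j 1)) s := by fun_prop
  exact ((ContinuousLinearMap.smulRightL ℂ (CSpace L) (CSpace L)
    ((ContinuousLinearMap.proj j).comp θ)).continuous.continuousAt).comp h1

theorem eventually_isUnit_frameShift {O : Set (EuclideanSpace ℝ (Fin m))} (hO : IsOpen O)
    (h0 : (0 : EuclideanSpace ℝ (Fin m)) ∈ O) (hg : ContDiffOn ℝ ∞ g O) :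
    ∀ᶠ s in 𝓝 0, IsUnit (frameShift g θ s) := by
  have h := (continuousAt_frameShift (θ := θ) hO hg h0)
  refine h.eventually (p := fun Φ => IsUnit Φ) ?_
  rw [frameShift_zero]
  exact Units.isOpen.mem_nhds isUnit_one

/-- Complex linear forms `Λ s`, continuous in `s`, that annihilate the tangent space `g'(s)` and
agree with a given form `l` on `ker θ`. -/
theorem exists_annihilating_forms {O : Set (EuclideanSpace ℝ (Fin m))} (hO : IsOpen O)
    (h0 : (0 : EuclideanSpace ℝ (Fin m)) ∈ O) (hg : ContDiffOn ℝ ∞ g O)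
    (hθ : ∀ u j, θ (fderiv ℝ g 0 u) j = ((u j : ℝ) : ℂ)) {l : CSpace L →L[ℂ] ℂ}
    (hl : ∀ u, l (fderiv ℝ g 0 u) = 0) :
    ∃ Λ : EuclideanSpace ℝ (Fin m) → CSpace L →L[ℂ] ℂ, ∀ᶠ s in 𝓝 0, ContinuousAt Λ s ∧
      (∀ u, Λ s (fderiv ℝ g s u) = 0) ∧ ∀ h, θ h = 0 → Λ s h = l h := by
  refine ⟨fun s => l.comp (Ring.inverse (frameShift g θ s)), ?_⟩
  filter_upwards [eventually_isUnit_frameShift (θ := θ) hO h0 hg, hO.mem_nhds h0] with s hs hsO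
  have hinv : ∀ z, Ring.inverse (frameShift g θ s) (frameShift g θ s z) = z := fun z => by
    have := congrArg (fun Φ : CSpace L →L[ℂ] CSpace L => Φ z) (Ring.inverse_mul_cancel _ hs)
    simpa using this
  refine ⟨?_, fun u => ?_, fun h hh => ?_⟩
  · have h1 : ContinuousAt Ring.inverse (frameShift g θ s) := by
      obtain ⟨y, hy⟩ := hs
      rw [← hy]
      exact NormedRing.inverse_continuousAt y
    have h2 : ContinuousAt (fun s => Ring.inverse (frameShift g θ s)) s :=
      ContinuousAt.comp (f := frameShift g θ) h1 (continuousAt_frameShift hO hg hsO)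
    exact continuousAt_const.clm_comp h2
  · rw [ContinuousLinearMap.comp_apply, ← frameShift_fderiv_zero hθ s u, hinv, hl]
  · rw [ContinuousLinearMap.comp_apply]
    conv_lhs => rw [← frameShift_of_ker (g := g) s hh, hinv]

end Frame

section Kernel

variable {L m : ℕ} {g : EuclideanSpace ℝ (Fin m) → CSpace L} {θ : CSpace L →L[ℂ] (Fin m → ℂ)}
  {Λ : EuclideanSpace ℝ (Fin m) → CSpace L →L[ℂ] ℂ}

/-- The kernel exponent `k Λ_s(z - g(s)) + ∑ θ_j(z - g(s))²`. The quadratic part reproduces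
`‖t - s‖²` along the submanifold `z = g(t)`, the linear part is positive in the direction of the
wedge and, as `Λ_s` annihilates the tangent space at `g(s)`, is small of second order along the
submanifold. -/
noncomputable def kernelExponent (g : EuclideanSpace ℝ (Fin m) → CSpace L)
    (θ : CSpace L →L[ℂ] (Fin m → ℂ)) (Λ : EuclideanSpace ℝ (Fin m) → CSpace L →L[ℂ] ℂ) (k : ℝ)
    (z : CSpace L) (s : EuclideanSpace ℝ (Fin m)) : ℂ :=
  k * Λ s (z - g s) + ∑ j, θ (z - g s) j ^ 2

/-- The derivative of `kernelExponent` in `z`. -/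
noncomputable def kernelExponentDeriv (g : EuclideanSpace ℝ (Fin m) → CSpace L)
    (θ : CSpace L →L[ℂ] (Fin m → ℂ)) (Λ : EuclideanSpace ℝ (Fin m) → CSpace L →L[ℂ] ℂ) (k : ℝ)
    (z : CSpace L) (s : EuclideanSpace ℝ (Fin m)) : CSpace L →L[ℂ] ℂ :=
  (k : ℂ) • Λ s + ∑ j, (2 * θ (z - g s) j) • (ContinuousLinearMap.proj j).comp θ

theorem hasFDerivAt_kernelExponent (k : ℝ) (z : CSpace L) (s : EuclideanSpace ℝ (Fin m)) :
    HasFDerivAt (fun z => kernelExponent g θ Λ k z s) (kernelExponentDeriv g θ Λ k z s) z := by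
  have h0 : HasFDerivAt (fun z : CSpace L => z - g s) (ContinuousLinearMap.id ℂ (CSpace L)) z :=
    (hasFDerivAt_id z).sub_const _
  have h1 : HasFDerivAt (fun z : CSpace L => Λ s (z - g s)) (Λ s) z :=
    (Λ s).hasFDerivAt.comp z h0
  have h2 : ∀ j, HasFDerivAt (fun z : CSpace L => θ (z - g s) j ^ 2)
      ((2 * θ (z - g s) j) • (ContinuousLinearMap.proj j).comp θ) z := fun j => by
    have h3 : HasFDerivAt (fun z : CSpace L => θ (z - g s) j)
        ((ContinuousLinearMap.proj j).comp θ) z :=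
      ((ContinuousLinearMap.proj (R := ℂ) (φ := fun _ : Fin m => ℂ) j).comp θ).hasFDerivAt.comp
        z h0
    simpa using h3.pow 2
  exact (h1.const_mul (k : ℂ)).add (HasFDerivAt.fun_sum fun j _ => h2 j)

theorem continuousOn_kernelExponent {B : Set (EuclideanSpace ℝ (Fin m))} (hg : ContinuousOn g B)
    (hΛ : ContinuousOn Λ B) (k : ℝ) :
    ContinuousOn (Function.uncurry (kernelExponent g θ Λ k)) (univ ×ˢ B) := by
  have hg' : ContinuousOn (fun q : CSpace L × EuclideanSpace ℝ (Fin m) => q.1 - g q.2)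
      (univ ×ˢ B) :=
    continuousOn_fst.sub (hg.comp continuousOn_snd fun q hq => hq.2)
  have hΛ' : ContinuousOn (fun q : CSpace L × EuclideanSpace ℝ (Fin m) => Λ q.2) (univ ×ˢ B) :=
    hΛ.comp continuousOn_snd fun q hq => hq.2
  have hθ' : ContinuousOn (fun q : CSpace L × EuclideanSpace ℝ (Fin m) => θ (q.1 - g q.2))
      (univ ×ˢ B) := θ.continuous.comp_continuousOn hg'
  exact (continuousOn_const.mul (hΛ'.clm_apply hg')).add
    (continuousOn_finsetSum _ fun j _ => ((continuousOn_pi.1 hθ') j).pow 2)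

theorem continuousOn_kernelExponentDeriv {B : Set (EuclideanSpace ℝ (Fin m))}
    (hg : ContinuousOn g B) (hΛ : ContinuousOn Λ B) (k : ℝ) :
    ContinuousOn (Function.uncurry (kernelExponentDeriv g θ Λ k)) (univ ×ˢ B) := by
  have hg' : ContinuousOn (fun q : CSpace L × EuclideanSpace ℝ (Fin m) => q.1 - g q.2)
      (univ ×ˢ B) :=
    continuousOn_fst.sub (hg.comp continuousOn_snd fun q hq => hq.2)
  have hΛ' : ContinuousOn (fun q : CSpace L × EuclideanSpace ℝ (Fin m) => Λ q.2) (univ ×ˢ B) :=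
    hΛ.comp continuousOn_snd fun q hq => hq.2
  have hθ' : ContinuousOn (fun q : CSpace L × EuclideanSpace ℝ (Fin m) => θ (q.1 - g q.2))
      (univ ×ˢ B) := θ.continuous.comp_continuousOn hg'
  have h1 : ContinuousOn (fun q : CSpace L × EuclideanSpace ℝ (Fin m) => (k : ℂ) • Λ q.2)
      (univ ×ˢ B) := hΛ'.fun_const_smul (k : ℂ)
  have h2 : ∀ j, ContinuousOn (fun q : CSpace L × EuclideanSpace ℝ (Fin m) =>
      (2 * θ (q.1 - g q.2) j) • ((ContinuousLinearMap.proj j).comp θ : CSpace L →L[ℂ] ℂ))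
      (univ ×ˢ B) := fun j =>
    (continuousOn_const.mul ((continuousOn_pi.1 hθ') j)).smul continuousOn_const
  exact h1.add (continuousOn_finsetSum Finset.univ fun j _ => h2 j)

theorem sum_coord_sq (u : EuclideanSpace ℝ (Fin m)) :
    ∑ j, ((u j : ℝ) : ℂ) ^ 2 = ((‖u‖ ^ 2 : ℝ) : ℂ) := by
  rw [EuclideanSpace.norm_sq_eq]
  simp

theorem norm_coord_le (u : EuclideanSpace ℝ (Fin m)) (j : Fin m) : ‖((u j : ℝ) : ℂ)‖ ≤ ‖u‖ := by
  rw [Complex.norm_real]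
  exact PiLp.norm_apply_le u j

/-- Near the origin the kernel exponent is `‖t - s‖²` on the submanifold, up to a given relative
error, and its real part does not decrease when one moves from the submanifold in the edge
directions `h` and then in the directions `γ` of a narrow cone about `v`. -/
theorem exists_kernelExponent_bounds {O : Set (EuclideanSpace ℝ (Fin m))} (hO : IsOpen O)
    (h0 : (0 : EuclideanSpace ℝ (Fin m)) ∈ O) (hg : ContDiffOn ℝ ∞ g O)
    (hθ : ∀ u j, θ (fderiv ℝ g 0 u) j = ((u j : ℝ) : ℂ)) {l : CSpace L →L[ℂ] ℂ}
    (hl : ∀ u, l (fderiv ℝ g 0 u) = 0) {v : CSpace L} (hlv : l v = 1) (hθv : θ v = 0) {δ : ℝ}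
    (hδ : 0 < δ) {U : Set (EuclideanSpace ℝ (Fin m))} (hU : U ∈ 𝓝 0) :
    ∃ (Λ : EuclideanSpace ℝ (Fin m) → CSpace L →L[ℂ] ℂ) (k r κ : ℝ), 0 < r ∧ 0 < κ ∧
      closedBall 0 (2 * r) ⊆ U ∩ O ∧ ContinuousOn Λ (closedBall 0 (2 * r)) ∧
      ∀ t ∈ closedBall 0 (2 * r), ∀ s ∈ closedBall 0 (2 * r),
        ‖kernelExponent g θ Λ k (g t) s - (‖t - s‖ ^ 2 : ℝ)‖ ≤ δ * ‖t - s‖ ^ 2 ∧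
        ∀ h γ : CSpace L, θ h = 0 → (l h).re = 0 → ‖γ - (l γ).re • v‖ ≤ κ * (l γ).re → ‖γ‖ ≤ 1 →
          (kernelExponent g θ Λ k (g t) s).re ≤ (kernelExponent g θ Λ k (g t + h + γ) s).re := by
  obtain ⟨Λ, hΛ⟩ := exists_annihilating_forms hO h0 hg hθ hl
  obtain ⟨K, hK0, ρ, hρ, hρO, hK1, hK2⟩ := exists_taylor_bound hO h0 hg
  set Q : ℝ := ‖Λ 0‖ + 1 with hQ
  have hQ0 : 0 < Q := by positivity
  have hΛQ : ∀ᶠ s in 𝓝 0, ‖Λ s‖ < Q :=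
    hΛ.self_of_nhds.1.norm.eventually_lt continuousAt_const (lt_add_one _)
  obtain ⟨ρ', hρ', hsub⟩ := Metric.mem_nhds_iff.1
    (inter_mem (inter_mem hU (ball_mem_nhds 0 hρ)) (hΛ.and hΛQ))
  set P : ℝ := ‖θ‖ with hP
  have hP0 : 0 ≤ P := norm_nonneg _
  set k : ℝ := δ / (2 * (Q * K + 1)) with hk
  have hk0 : 0 < k := by positivity
  have hkQ : k * (Q * K) ≤ δ / 2 := by
    rw [hk, div_mul_eq_mul_div, div_le_div_iff₀ (by positivity) two_pos]
    nlinarith [mul_nonneg hQ0.le hK0]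
  -- `ε` is the relative error of the first order approximation.
  obtain ⟨ε, hε0, hε1, hε2⟩ : ∃ ε : ℝ, 0 < ε ∧ ε ≤ 1 ∧ m * (3 * ε) ≤ δ / 2 := by
    refine ⟨min 1 (δ / (6 * (m + 1))), by positivity, min_le_left _ _, ?_⟩
    have h1 : min 1 (δ / (6 * (m + 1))) ≤ δ / (6 * ((m : ℝ) + 1)) := min_le_right _ _
    have h2 : (m : ℝ) * (3 * (δ / (6 * ((m : ℝ) + 1)))) = δ / 2 * (m / (m + 1)) := by
      field_simp; ring
    have h3 : (m : ℝ) / (m + 1) ≤ 1 := by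
      rw [div_le_one (by positivity)]; linarith
    calc (m : ℝ) * (3 * min 1 (δ / (6 * (m + 1)))) ≤ m * (3 * (δ / (6 * ((m : ℝ) + 1)))) := by
          gcongr
      _ ≤ δ / 2 * 1 := by rw [h2]; gcongr
      _ = δ / 2 := mul_one _
  obtain ⟨r, hr0, hr1, hr2, hr3⟩ : ∃ r : ℝ, 0 < r ∧ r ≤ 1 ∧ 2 * r < ρ' ∧ P * (6 * K * r) ≤ ε := by
    refine ⟨min 1 (min (ρ' / 4) (ε / (6 * P * K + 1))), by positivity, min_le_left _ _, ?_, ?_⟩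
    · have : min 1 (min (ρ' / 4) (ε / (6 * P * K + 1))) ≤ ρ' / 4 :=
        (min_le_right _ _).trans (min_le_left _ _)
      linarith
    · have h1 : min 1 (min (ρ' / 4) (ε / (6 * P * K + 1))) ≤ ε / (6 * P * K + 1) :=
        (min_le_right _ _).trans (min_le_right _ _)
      calc P * (6 * K * min 1 (min (ρ' / 4) (ε / (6 * P * K + 1))))
          ≤ P * (6 * K * (ε / (6 * P * K + 1))) := by gcongr
        _ = ε * (6 * P * K / (6 * P * K + 1)) := by ring
        _ ≤ ε * 1 := by
          gcongr
          rw [div_le_one (by positivity)]; linarith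
        _ = ε := mul_one _
  -- The aperture `k / Z` of the cone is chosen so that the loss in `Re b`, which is at most
  -- `(k Q + m (16 + P) P) (k / Z) Re l γ`, stays below the gain `k Re l γ`.
  set Z : ℝ := k * Q + m * ((16 + P) * P) + 1 with hZ
  have hZ0 : 0 < Z := by positivity
  have hB : closedBall (0 : EuclideanSpace ℝ (Fin m)) (2 * r) ⊆ ball 0 ρ' :=
    closedBall_subset_ball hr2
  refine ⟨Λ, k, r, k / Z, hr0, by positivity, fun s hs => ?_, fun s hs => ?_, ?_⟩
  · have := hsub (hB hs)
    exact ⟨this.1.1, hρO this.1.2⟩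
  · exact (hsub (hB hs)).2.1.1.continuousWithinAt
  intro t ht s hs
  obtain ⟨⟨-, hsρ⟩, ⟨-, hΛs, hΛl⟩, hΛQs⟩ := hsub (hB hs)
  have htρ := (hsub (hB ht)).1.2
  rw [mem_closedBall, dist_zero_right] at ht hs
  have hts : ‖t - s‖ ≤ 4 * r := (norm_sub_le _ _).trans (by linarith)
  set w : CSpace L := g t - g s - fderiv ℝ g 0 (t - s) with hw
  have hwn : ‖w‖ ≤ 6 * K * r * ‖t - s‖ := by
    have e : w = (g t - g s - fderiv ℝ g s (t - s))
        + (fderiv ℝ g s - fderiv ℝ g 0) (t - s) := by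
      rw [hw, sub_apply]; abel
    rw [e]
    calc _ ≤ K * ‖t - s‖ ^ 2 + K * ‖s‖ * ‖t - s‖ :=
          norm_add_le_of_le (hK2 s hsρ t htρ)
            (((fderiv ℝ g s - fderiv ℝ g 0).le_opNorm _).trans (by gcongr; exact hK1 s hsρ))
      _ = K * (‖t - s‖ + ‖s‖) * ‖t - s‖ := by ring
      _ ≤ K * (4 * r + 2 * r) * ‖t - s‖ := by gcongr
      _ = 6 * K * r * ‖t - s‖ := by ring
  have hθw : ∀ j, ‖θ w j‖ ≤ ε * ‖t - s‖ := fun j =>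
    calc ‖θ w j‖ ≤ ‖θ w‖ := norm_le_pi_norm _ j
      _ ≤ P * ‖w‖ := θ.le_opNorm w
      _ ≤ P * (6 * K * r * ‖t - s‖) := by gcongr
      _ = P * (6 * K * r) * ‖t - s‖ := by ring
      _ ≤ ε * ‖t - s‖ := by gcongr
  have hθg : ∀ j, θ (g t - g s) j = (((t - s) j : ℝ) : ℂ) + θ w j := fun j => by
    rw [← hθ (t - s) j, ← Pi.add_apply, ← map_add, hw, add_sub_cancel]
  constructor
  · have hlin : ‖(k : ℂ) * Λ s (g t - g s)‖ ≤ δ / 2 * ‖t - s‖ ^ 2 := by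
      have e : Λ s (g t - g s) = Λ s (g t - g s - fderiv ℝ g s (t - s)) := by
        rw [map_sub (Λ s) (g t - g s), hΛs, sub_zero]
      rw [e, norm_mul, Complex.norm_real, Real.norm_of_nonneg hk0.le]
      calc k * ‖Λ s (g t - g s - fderiv ℝ g s (t - s))‖
          ≤ k * (Q * (K * ‖t - s‖ ^ 2)) := by
            gcongr
            exact (Λ s).le_of_opNorm_le_of_le hΛQs.le (hK2 s hsρ t htρ)
        _ = k * (Q * K) * ‖t - s‖ ^ 2 := by ring
        _ ≤ δ / 2 * ‖t - s‖ ^ 2 := by gcongr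
    have hquad : ‖∑ j, θ (g t - g s) j ^ 2 - ((‖t - s‖ ^ 2 : ℝ) : ℂ)‖ ≤ δ / 2 * ‖t - s‖ ^ 2 := by
      rw [← sum_coord_sq]
      simp only [hθg]
      refine (norm_sum_add_sq_sub_le (fun j => norm_coord_le (t - s) j) hθw).trans ?_
      rw [Fintype.card_fin]
      calc (m : ℝ) * ((2 * ‖t - s‖ + ε * ‖t - s‖) * (ε * ‖t - s‖))
          = m * ((2 + ε) * ε) * ‖t - s‖ ^ 2 := by ring
        _ ≤ m * (3 * ε) * ‖t - s‖ ^ 2 := by gcongr; linarith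
        _ ≤ δ / 2 * ‖t - s‖ ^ 2 := by gcongr
    rw [kernelExponent, add_sub_assoc]
    exact (norm_add_le_of_le hlin hquad).trans (le_of_eq (by ring))
  · intro h γ hθh hlh hγ hγ1
    set x : ℝ := (l γ).re with hx
    have hκ : 0 < k / Z := by positivity
    have hx0 : 0 ≤ x := nonneg_of_mul_nonneg_right ((norm_nonneg _).trans hγ) hκ
    set γ₁ : CSpace L := γ - x • v with hγ₁
    have hγe : γ = (x : ℂ) • v + γ₁ := by rw [hγ₁, Complex.coe_smul, add_sub_cancel]
    have hθγ : θ γ = θ γ₁ := by rw [hγe, map_add, map_smul, hθv, smul_zero, zero_add]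
    have hΛγ : Λ s γ = x + Λ s γ₁ := by
      rw [hγe, map_add, map_smul, hΛl v hθv, hlv, smul_eq_mul, mul_one]
    have hθγn : ∀ j, ‖θ γ j‖ ≤ P := fun j =>
      (norm_le_pi_norm _ j).trans ((θ.le_opNorm γ).trans (mul_le_of_le_one_right hP0 hγ1))
    have hθγn' : ∀ j, ‖θ γ j‖ ≤ P * (k / Z * x) := fun j => by
      rw [hθγ]
      exact (norm_le_pi_norm _ j).trans ((θ.le_opNorm γ₁).trans (by gcongr))
    -- One factor of the quadratic error uses the bound by `P`, the other one the bound by `Re l γ`.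
    have hβ : ∀ j, ‖θ γ j‖ ≤ min P (P * (k / Z * x)) := fun j => le_min (hθγn j) (hθγn' j)
    have ha : ∀ j, ‖θ (g t - g s) j‖ ≤ 8 := fun j => by
      rw [hθg]
      have h1 := norm_coord_le (t - s) j
      have h2 := hθw j
      have h3 : ε * ‖t - s‖ ≤ 1 * ‖t - s‖ := by gcongr
      exact (norm_add_le _ _).trans (by linarith)
    have hsq := norm_sum_add_sq_sub_le ha hβ
    rw [Fintype.card_fin] at hsq
    have hb0 : 0 ≤ min P (P * (k / Z * x)) := le_min hP0 (by positivity)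
    have hsq' : ‖∑ j, (θ (g t - g s) j + θ γ j) ^ 2 - ∑ j, θ (g t - g s) j ^ 2‖
        ≤ m * ((16 + P) * P) * (k / Z * x) := by
      refine hsq.trans ?_
      calc (m : ℝ) * ((2 * 8 + min P (P * (k / Z * x))) * min P (P * (k / Z * x)))
          ≤ m * ((2 * 8 + P) * (P * (k / Z * x))) := by
            gcongr
            · exact min_le_left _ _
            · exact min_le_right _ _
        _ = m * ((16 + P) * P) * (k / Z * x) := by ring
    have hΛh : (Λ s h).re = 0 := by rw [hΛl h hθh, hlh]
    have hΛγ₁ : ‖Λ s γ₁‖ ≤ Q * (k / Z * x) := (Λ s).le_of_opNorm_le_of_le hΛQs.le hγ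
    have hθz : ∀ j, θ (g t + h + γ - g s) j = θ (g t - g s) j + θ γ j := fun j => by
      have e : g t + h + γ - g s = (g t - g s) + h + γ := by abel
      rw [e, map_add, map_add, hθh, add_zero, Pi.add_apply]
    have hΛz : Λ s (g t + h + γ - g s) = Λ s (g t - g s) + Λ s h + (x + Λ s γ₁) := by
      have e : g t + h + γ - g s = (g t - g s) + h + γ := by abel
      rw [e, map_add, map_add, hΛγ]
    have h1 := (abs_le.1 ((Complex.abs_re_le_norm _).trans hsq')).1
    have h2 := (abs_le.1 ((Complex.abs_re_le_norm _).trans hΛγ₁)).1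
    rw [Complex.sub_re] at h1
    simp only [kernelExponent, hθz, hΛz, Complex.add_re, Complex.re_ofReal_mul, hΛh,
      Complex.ofReal_re, add_zero]
    have h3 : k * x = (k * Q + m * ((16 + P) * P) + 1) * (k / Z * x) := by
      rw [← hZ]; field_simp
    have h4 : 0 ≤ k / Z * x := by positivity
    have h5 : k * -(Q * (k / Z * x)) ≤ k * (Λ s γ₁).re := by gcongr
    linarith

end Kernel

/-! ### Tangent vectors, parametrizations and adapted linear forms -/

section Geometry

variable {L m : ℕ}

/-- A curve needs to lie in `N` only near time `0`: elsewhere it may be replaced by a constant. -/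
theorem mem_tangentSpace_of_eventually {N : Set (CSpace L)} {x w : CSpace L} {c : ℝ → CSpace L}
    (h0 : c 0 = x) (hc : ∀ᶠ t in 𝓝 0, c t ∈ N) (hw : HasDerivAt c w 0) :
    w ∈ tangentSpace N x := by
  classical
  refine Submodule.subset_span ⟨fun t => if c t ∈ N then c t else x, ?_, fun t => ?_, ?_⟩
  · simp [h0]
  · have hx : x ∈ N := h0 ▸ hc.self_of_nhds
    beta_reduce
    split_ifs with h
    · exact h
    · exact hx
  · refine hw.congr_of_eventuallyEq (hc.mono fun t ht => ?_)
    simp [ht]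

/-- A submanifold has a smooth local parametrization `g` by `ℝ^m` that is an immersion at the origin
and covers the points of `N` near `p` by parameters in any given neighbourhood of the origin. -/
theorem IsSmoothSubmanifold.exists_parametrization {N : Set (CSpace L)}
    (hN : IsSmoothSubmanifold m N) {p : CSpace L} (hp : p ∈ N) :
    ∃ (g : EuclideanSpace ℝ (Fin m) → CSpace L) (O : Set (EuclideanSpace ℝ (Fin m))),
      IsOpen O ∧ 0 ∈ O ∧ ContDiffOn ℝ ∞ g O ∧ g 0 = p ∧ (∀ t ∈ O, g t ∈ N) ∧
      (∀ O' ∈ 𝓝 (0 : EuclideanSpace ℝ (Fin m)), ∀ᶠ x in 𝓝 p, x ∈ N → ∃ t ∈ O', g t = x) ∧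
      Function.Injective (fderiv ℝ g 0) := by
  obtain ⟨e, S, hx, he, hes, hS, hNe⟩ := hN p hp
  have hfr : Module.finrank ℝ (EuclideanSpace ℝ (Fin m)) = Module.finrank ℝ S := by simp [hS]
  set ε := LinearEquiv.ofFinrankEq (EuclideanSpace ℝ (Fin m)) S hfr with hε
  set ι₀ : EuclideanSpace ℝ (Fin m) →ₗ[ℝ] CSpace L := S.subtype ∘ₗ ε.toLinearMap with hι₀
  obtain ⟨π₀, hπ₀⟩ := ι₀.exists_leftInverse_of_injective (by
    rw [LinearMap.ker_eq_bot]
    exact S.injective_subtype.comp ε.injective)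
  set ι : EuclideanSpace ℝ (Fin m) →L[ℝ] CSpace L := LinearMap.toContinuousLinearMap ι₀ with hι
  set π : CSpace L →L[ℝ] EuclideanSpace ℝ (Fin m) := LinearMap.toContinuousLinearMap π₀ with hπ
  have hπι : ∀ t, π (ι t) = t := fun t => congrArg (fun f => f t) hπ₀
  have hιS : ∀ t, ι t ∈ S := fun t => (ε t).2
  have hιπ : ∀ y ∈ S, ι (π y) = y := fun y hy => by
    have h : ι (ε.symm ⟨y, hy⟩) = y := by
      change ((ε (ε.symm ⟨y, hy⟩) : S) : CSpace L) = y
      rw [ε.apply_symm_apply]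
    rw [← h, hπι]
  have hpS : e p ∈ S := (hNe p hx).1 hp
  set a : EuclideanSpace ℝ (Fin m) → CSpace L := fun t => e p + ι t with ha
  have hac : ContDiff ℝ ∞ a := contDiff_const.add ι.contDiff
  set O : Set (EuclideanSpace ℝ (Fin m)) := a ⁻¹' e.target with hO
  set g : EuclideanSpace ℝ (Fin m) → CSpace L := fun t => e.symm (a t) with hg
  have ha0 : a 0 = e p := by simp [ha]
  have hg0 : g 0 = p := by rw [hg]; simp only [ha0]; exact e.left_inv hx
  have hOo : IsOpen O := e.open_target.preimage hac.continuous
  have h0O : (0 : EuclideanSpace ℝ (Fin m)) ∈ O := by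
    rw [hO, mem_preimage, ha0]; exact e.map_source hx
  have hgO : ContDiffOn ℝ ∞ g O := hes.comp hac.contDiffOn fun t ht => ht
  have hright : ∀ t ∈ O, π (e (g t) - e p) = t := fun t ht => by
    rw [hg]; simp only []; rw [e.right_inv ht, ha, add_sub_cancel_left, hπι]
  refine ⟨g, O, hOo, h0O, hgO, hg0, fun t ht => ?_, fun O' hO' => ?_, ?_⟩
  · rw [hNe _ (e.map_target ht), e.right_inv ht]
    exact S.add_mem hpS (hιS t)
  · have hc : ContinuousAt (fun x => π (e x - e p)) p :=
      π.continuous.continuousAt.comp ((e.continuousAt hx).sub continuousAt_const)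
    have hc' : ∀ᶠ x in 𝓝 p, π (e x - e p) ∈ O' := hc.eventually (by simpa using hO')
    filter_upwards [hc', e.open_source.mem_nhds hx] with x hx1 hx2 hxN
    refine ⟨_, hx1, ?_⟩
    have hxS : e x - e p ∈ S := S.sub_mem ((hNe x hx2).1 hxN) hpS
    rw [hg]
    simp only [ha]
    rw [hιπ _ hxS, add_sub_cancel, e.left_inv hx2]
  · have hgd : HasFDerivAt g (fderiv ℝ g 0) 0 :=
      ((hgO.contDiffAt (hOo.mem_nhds h0O)).differentiableAt (by norm_num)).hasFDerivAt
    have hed : HasFDerivAt e (fderiv ℝ e p) (g 0) := by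
      rw [hg0]
      exact ((he.contDiffAt (e.open_source.mem_nhds hx)).differentiableAt
        (by norm_num)).hasFDerivAt
    have hcomp : HasFDerivAt (fun t => π (e (g t) - e p)) (π.comp ((fderiv ℝ e p).comp
        (fderiv ℝ g 0))) 0 :=
      π.hasFDerivAt.comp (0 : EuclideanSpace ℝ (Fin m)) ((hed.comp 0 hgd).sub_const (e p))
    have hid : HasFDerivAt (fun t => π (e (g t) - e p))
        (ContinuousLinearMap.id ℝ (EuclideanSpace ℝ (Fin m))) 0 :=
      (hasFDerivAt_id 0).congr_of_eventuallyEq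
        (eventually_of_mem (hOo.mem_nhds h0O) fun t ht => hright t ht)
    have heq := hcomp.unique hid
    exact Function.LeftInverse.injective (g := fun y => π (fderiv ℝ e p y))
      fun t => congrArg (fun f => f t) heq

/-- A totally real subspace together with a complex transversal vector `v` admits complex linear
coordinates in which the subspace is `ℝ^m ⊂ ℂ^m` and `v` is the next coordinate vector. -/
theorem exists_adapted_forms {T : EuclideanSpace ℝ (Fin m) →L[ℝ] CSpace L}
    {N : Set (CSpace L)} {p v : CSpace L} (hT : Function.Injective T)
    (hTN : ∀ u, T u ∈ tangentSpace N p)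
    (hreal : ∀ w ∈ tangentSpace N p, Complex.I • w ∈ tangentSpace N p → w = 0)
    (hv : IsComplexTransversal N p v) :
    ∃ (θ : CSpace L →L[ℂ] (Fin m → ℂ)) (l : CSpace L →L[ℂ] ℂ),
      (∀ u j, θ (T u) j = ((u j : ℝ) : ℂ)) ∧ (∀ u, l (T u) = 0) ∧ l v = 1 ∧ θ v = 0 := by
  set J : ((Fin m → ℂ) × ℂ) →ₗ[ℂ] CSpace L :=
    LinearMap.coprod (Fintype.linearCombination ℂ fun j => T (EuclideanSpace.single j 1))
      (LinearMap.toSpanSingleton ℂ (CSpace L) v) with hJ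
  have hJa : ∀ c d, J (c, d) = ∑ j, c j • T (EuclideanSpace.single j 1) + d • v := fun c d => by
    simp [hJ, Fintype.linearCombination_apply]
  have hJT : ∀ u : EuclideanSpace ℝ (Fin m), J (fun j => ((u j : ℝ) : ℂ), 0) = T u := fun u => by
    rw [hJa, zero_smul, add_zero, sum_coord_smul_apply_single]
  have hker : LinearMap.ker J = ⊥ := by
    rw [LinearMap.ker_eq_bot']
    rintro ⟨c, d⟩ hcd
    rw [hJa] at hcd
    have hsum : ∑ j, c j • T (EuclideanSpace.single j 1) ∈ complexTangentSpan N p :=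
      Submodule.sum_mem _ fun j _ => Submodule.smul_mem _ _ (Submodule.subset_span (hTN _))
    have hd : d = 0 := by
      by_contra hd
      refine hv ?_
      have : d • v ∈ complexTangentSpan N p := by
        rw [← eq_neg_iff_add_eq_zero, ← neg_eq_iff_eq_neg] at hcd
        rw [← hcd]
        exact Submodule.neg_mem _ hsum
      simpa [smul_smul, inv_mul_cancel₀ hd] using Submodule.smul_mem _ d⁻¹ this
    subst hd
    rw [zero_smul, add_zero] at hcd
    set a : EuclideanSpace ℝ (Fin m) := WithLp.toLp 2 fun j => (c j).re with ha
    set b : EuclideanSpace ℝ (Fin m) := WithLp.toLp 2 fun j => (c j).im with hb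
    have hab : T a + Complex.I • T b = 0 := by
      rw [← sum_coord_smul_apply_single T a, ← sum_coord_smul_apply_single T b, Finset.smul_sum,
        ← Finset.sum_add_distrib, ← hcd]
      refine Finset.sum_congr rfl fun j _ => ?_
      rw [smul_smul, ← add_smul]
      congr 1
      rw [mul_comm]
      exact Complex.re_add_im (c j)
    have hTb : T b = 0 := by
      refine hreal _ (hTN b) ?_
      have : Complex.I • T b = T (-a) := by
        rw [map_neg]; exact eq_neg_of_add_eq_zero_right hab
      rw [this]
      exact hTN _
    have hTa : T a = 0 := by simpa [hTb] using hab
    have ha0 : a = 0 := hT (by rw [hTa, map_zero])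
    have hb0 : b = 0 := hT (by rw [hTb, map_zero])
    have : c = 0 := by
      funext j
      refine Complex.ext ?_ ?_
      · simpa [ha] using congrArg (fun u : EuclideanSpace ℝ (Fin m) => u j) ha0
      · simpa [hb] using congrArg (fun u : EuclideanSpace ℝ (Fin m) => u j) hb0
    rw [this]; rfl
  obtain ⟨ψ, hψ⟩ := J.exists_leftInverse_of_injective hker
  have hψJ : ∀ q, ψ (J q) = q := fun q => congrArg (fun f => f q) hψ
  have hJv : J (0, 1) = v := by rw [hJa]; simp
  refine ⟨LinearMap.toContinuousLinearMap (LinearMap.fst ℂ (Fin m → ℂ) ℂ ∘ₗ ψ),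
    LinearMap.toContinuousLinearMap (LinearMap.snd ℂ (Fin m → ℂ) ℂ ∘ₗ ψ), fun u j => ?_,
    fun u => ?_, ?_, ?_⟩
  · change (ψ (T u)).1 j = _
    rw [← hJT, hψJ]
  · change (ψ (T u)).2 = _
    rw [← hJT, hψJ]
  · change (ψ v).2 = _
    rw [← hJv, hψJ]
  · change (ψ v).1 = _
    rw [← hJv, hψJ]

end Geometry

/-! ### The generic edge -/

section Edge

variable {L m : ℕ}

/-- The real parts of the first `m` coordinates `θ`. -/
noncomputable def rePart (θ : CSpace L →L[ℂ] (Fin m → ℂ)) :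
    CSpace L →L[ℝ] EuclideanSpace ℝ (Fin m) :=
  LinearMap.toContinuousLinearMap
    { toFun := fun x => WithLp.toLp 2 fun j => (θ x j).re
      map_add' := fun x y => by ext j; simp
      map_smul' := fun c x => by
        ext j
        rw [← Complex.coe_smul, map_smul]
        simp }

theorem rePart_apply (θ : CSpace L →L[ℂ] (Fin m → ℂ)) (x : CSpace L) (j : Fin m) :
    rePart θ x j = (θ x j).re := rfl

/-- The real subspace where the coordinates `θ` are real and `l` is imaginary: the tangent space of
the edge. -/
def edgeSubspace (θ : CSpace L →L[ℂ] (Fin m → ℂ)) (l : CSpace L →L[ℂ] ℂ) :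
    Submodule ℝ (CSpace L) where
  carrier := {x | (∀ j, (θ x j).im = 0) ∧ (l x).re = 0}
  add_mem' := by
    rintro x y ⟨hx, hx'⟩ ⟨hy, hy'⟩
    exact ⟨fun j => by simp [hx j, hy j], by simp [hx', hy']⟩
  zero_mem' := by simp
  smul_mem' := by
    rintro c x ⟨hx, hx'⟩
    rw [mem_ofPred_eq, ← Complex.coe_smul, map_smul, map_smul]
    exact ⟨fun j => by simp [hx j], by simp [hx']⟩

variable {g : EuclideanSpace ℝ (Fin m) → CSpace L} {O : Set (EuclideanSpace ℝ (Fin m))}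
  {θ : CSpace L →L[ℂ] (Fin m → ℂ)}

/-- Replaces the tangent directions `g'(0) t` by the points `g(t)` of the submanifold: a local
diffeomorphism that carries `edgeSubspace` onto the edge. -/
noncomputable def edgeChart (g : EuclideanSpace ℝ (Fin m) → CSpace L)
    (θ : CSpace L →L[ℂ] (Fin m → ℂ)) (x : CSpace L) : CSpace L :=
  x + (g (rePart θ x) - fderiv ℝ g 0 (rePart θ x))

/-- The derivative of `edgeChart`. -/
noncomputable def edgeChartDeriv (g : EuclideanSpace ℝ (Fin m) → CSpace L)
    (θ : CSpace L →L[ℂ] (Fin m → ℂ)) (x : CSpace L) : CSpace L →L[ℝ] CSpace L :=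
  ContinuousLinearMap.id ℝ (CSpace L) +
    (fderiv ℝ g (rePart θ x) - fderiv ℝ g 0).comp (rePart θ)

theorem contDiffAt_edgeChart (hO : IsOpen O) (hg : ContDiffOn ℝ ∞ g O) {x : CSpace L}
    (hx : rePart θ x ∈ O) : ContDiffAt ℝ ∞ (edgeChart g θ) x := by
  have h1 : ContDiffAt ℝ ∞ (fun x => g (rePart θ x)) x :=
    (hg.contDiffAt (hO.mem_nhds hx)).comp x (rePart θ).contDiff.contDiffAt
  exact contDiffAt_id.add (h1.sub ((fderiv ℝ g 0).contDiff.comp (rePart θ).contDiff).contDiffAt)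

theorem hasFDerivAt_edgeChart (hO : IsOpen O) (hg : ContDiffOn ℝ ∞ g O) {x : CSpace L}
    (hx : rePart θ x ∈ O) : HasFDerivAt (edgeChart g θ) (edgeChartDeriv g θ x) x := by
  have h0 : HasFDerivAt g (fderiv ℝ g (rePart θ x)) (rePart θ x) :=
    ((hg.contDiffAt (hO.mem_nhds hx)).differentiableAt (by norm_num)).hasFDerivAt
  have h1 := h0.comp x (rePart θ).hasFDerivAt
  have h2 := (fderiv ℝ g 0).hasFDerivAt.comp x (rePart θ).hasFDerivAt
  have h3 := (hasFDerivAt_id (𝕜 := ℝ) x).add (h1.sub h2)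
  refine h3.congr_fderiv ?_
  ext1 y
  simp [edgeChartDeriv]

theorem edgeChartDeriv_zero :
    edgeChartDeriv g θ 0 = ContinuousLinearMap.id ℝ (CSpace L) := by
  simp [edgeChartDeriv]

theorem continuousAt_edgeChartDeriv (hO : IsOpen O) (hg : ContDiffOn ℝ ∞ g O) {x : CSpace L}
    (hx : rePart θ x ∈ O) : ContinuousAt (edgeChartDeriv g θ) x := by
  have hd : ContinuousAt (fderiv ℝ g) (rePart θ x) :=
    ((hg.contDiffAt (hO.mem_nhds hx)).fderiv_right (m := 0) (by norm_cast)).continuousAt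
  have hd' : ContinuousAt (fun x => fderiv ℝ g (rePart θ x)) x :=
    hd.comp (f := rePart θ) (rePart θ).continuous.continuousAt
  exact continuousAt_const.add ((hd'.sub continuousAt_const).clm_comp continuousAt_const)

/-- Genericity of the edge: its tangent space contains `g'(s) u` for all `u`, the kernel of `θ` and
`l`, and `i v`, and these span `ℂ^L` over `ℂ` because `frameShift` is invertible. -/
theorem span_edgeChartDeriv_eq_top (hθ : ∀ u j, θ (fderiv ℝ g 0 u) j = ((u j : ℝ) : ℂ))
    {l : CSpace L →L[ℂ] ℂ} (hl : ∀ u, l (fderiv ℝ g 0 u) = 0) {v : CSpace L} (hlv : l v = 1)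
    (hθv : θ v = 0) {x : CSpace L} (hx : IsUnit (frameShift g θ (rePart θ x))) :
    Submodule.span ℂ (edgeChartDeriv g θ x '' (edgeSubspace θ l : Set (CSpace L))) = ⊤ := by
  rw [eq_top_iff]
  rintro z -
  set s := rePart θ x with hs
  have hmem : ∀ u ∈ edgeSubspace θ l, edgeChartDeriv g θ x u ∈
      Submodule.span ℂ (edgeChartDeriv g θ x '' (edgeSubspace θ l : Set (CSpace L))) :=
    fun u hu => Submodule.subset_span ⟨u, hu, rfl⟩
  set W := Submodule.span ℂ (edgeChartDeriv g θ x '' (edgeSubspace θ l : Set (CSpace L)))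
  have hker : ∀ h, θ h = 0 → (l h).re = 0 → h ∈ W := fun h hh hlh => by
    have hre : rePart θ h = 0 := by ext j; rw [rePart_apply, hh]; rfl
    have := hmem h ⟨fun j => by rw [hh]; rfl, hlh⟩
    simpa [edgeChartDeriv, hre] using this
  have htan : ∀ u, fderiv ℝ g s u ∈ W := fun u => by
    have hre : rePart θ (fderiv ℝ g 0 u) = u := by
      ext j; rw [rePart_apply, hθ, Complex.ofReal_re]
    have := hmem (fderiv ℝ g 0 u) ⟨fun j => by rw [hθ, Complex.ofReal_im], by rw [hl]; rfl⟩
    simpa [edgeChartDeriv, hre, ← hs] using this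
  have hv : v ∈ W := by
    have h1 : Complex.I • v ∈ W :=
      hker _ (by rw [map_smul, hθv, smul_zero]) (by rw [map_smul, hlv]; simp)
    have h2 := W.smul_mem (-Complex.I) h1
    rwa [smul_smul, neg_mul, Complex.I_mul_I, neg_neg, one_smul] at h2
  have hker' : ∀ h, θ h = 0 → h ∈ W := fun h hh => by
    have e : h = (h - l h • v) + l h • v := by abel
    rw [e]
    refine W.add_mem (hker _ ?_ ?_) (W.smul_mem _ hv)
    · rw [map_sub, map_smul, hh, hθv, smul_zero, sub_zero]
    · rw [map_sub, map_smul, hlv, smul_eq_mul, mul_one, sub_self]; rfl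
  obtain ⟨z₀, rfl⟩ : ∃ z₀, frameShift g θ s z₀ = z := by
    refine ⟨Ring.inverse (frameShift g θ s) z, ?_⟩
    have := congrArg (fun Φ : CSpace L →L[ℂ] CSpace L => Φ z) (Ring.mul_inverse_cancel _ hx)
    simpa using this
  have e : frameShift g θ s z₀
      = (z₀ - ∑ j, θ z₀ j • fderiv ℝ g 0 (EuclideanSpace.single j 1))
        + ∑ j, θ z₀ j • fderiv ℝ g s (EuclideanSpace.single j 1) := by
    rw [frameShift_apply]
    simp only [smul_sub, Finset.sum_sub_distrib]
    abel
  rw [e]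
  refine W.add_mem (hker' _ ?_) (W.sum_mem fun j _ => W.smul_mem _ (htan _))
  rw [map_sub, map_sum, sub_eq_zero]
  funext i
  simp [hθ, Finset.sum_apply, apply_ite Complex.ofReal]

/-- The edge: a generic submanifold through the points `g(t)`, all of whose points are of the form
`g(t) + h` with `h` in the fixed subspace `θ h = 0`, `Re l h = 0`. -/
theorem exists_edge (hO : IsOpen O) (h0 : 0 ∈ O) (hg : ContDiffOn ℝ ∞ g O)
    (hθ : ∀ u j, θ (fderiv ℝ g 0 u) j = ((u j : ℝ) : ℂ))
    {l : CSpace L →L[ℂ] ℂ} (hl : ∀ u, l (fderiv ℝ g 0 u) = 0) {v : CSpace L} (hlv : l v = 1)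
    (hθv : θ v = 0) {U : Set (EuclideanSpace ℝ (Fin m))} (hU : U ∈ 𝓝 0) :
    ∃ E : Set (CSpace L), (∃ d, IsSmoothSubmanifold d E) ∧ IsGeneric E ∧
      (∀ᶠ t in 𝓝 0, g t ∈ E) ∧
      (∀ x ∈ E, ∃ t ∈ U, ∃ h, θ h = 0 ∧ (l h).re = 0 ∧ x = g t + h) ∧
      ∀ w ∈ tangentSpace E (g 0), (l w).re = 0 := by
  set Ψ := edgeChart g θ with hΨ
  set D := edgeChartDeriv g θ with hD
  have hP0 : rePart θ 0 = 0 := map_zero _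
  have hP : ContinuousAt (rePart θ) 0 := (rePart θ).continuous.continuousAt
  have hPT : ∀ t, rePart θ (fderiv ℝ g 0 t) = t := fun t => by
    ext j; rw [rePart_apply, hθ, Complex.ofReal_re]
  have hΨT : ∀ t, Ψ (fderiv ℝ g 0 t) = g t := fun t => by
    rw [hΨ, edgeChart, hPT, add_sub_cancel]
  have hTS : ∀ t, fderiv ℝ g 0 t ∈ edgeSubspace θ l := fun t =>
    ⟨fun j => by rw [hθ, Complex.ofReal_im], by rw [hl]; rfl⟩
  have hev : ∀ᶠ x in 𝓝 (0 : CSpace L), rePart θ x ∈ O ∧ rePart θ x ∈ U ∧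
      IsUnit (frameShift g θ (rePart θ x)) ∧
      D x ∈ range (ContinuousLinearEquiv.toContinuousLinearMap :
        (CSpace L ≃L[ℝ] CSpace L) → CSpace L →L[ℝ] CSpace L) := by
    have h1 := hP.eventually (p := fun s => s ∈ O) (by rw [hP0]; exact hO.mem_nhds h0)
    have h2 := hP.eventually (p := fun s => s ∈ U) (by rw [hP0]; exact hU)
    have h3 := hP.eventually (p := fun s => IsUnit (frameShift g θ s))
      (by rw [hP0]; exact eventually_isUnit_frameShift hO h0 hg)
    have h4 := (continuousAt_edgeChartDeriv (θ := θ) hO hg (x := 0) (by rwa [hP0])).eventually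
      (p := fun A => A ∈ range (ContinuousLinearEquiv.toContinuousLinearMap :
        (CSpace L ≃L[ℝ] CSpace L) → CSpace L →L[ℝ] CSpace L)) (by
        rw [edgeChartDeriv_zero]
        exact (ContinuousLinearEquiv.refl ℝ (CSpace L)).nhds)
    filter_upwards [h1, h2, h3, h4] with x hx1 hx2 hx3 hx4 using ⟨hx1, hx2, hx3, hx4⟩
  obtain ⟨G, hG, hGo, h0G⟩ := _root_.eventually_nhds_iff.1 hev
  have hder0 : HasFDerivAt Ψ ((ContinuousLinearEquiv.refl ℝ (CSpace L) :
      CSpace L ≃L[ℝ] CSpace L) : CSpace L →L[ℝ] CSpace L) 0 := by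
    have := hasFDerivAt_edgeChart (θ := θ) hO hg (x := 0) (by rwa [hP0])
    rw [edgeChartDeriv_zero] at this
    exact this
  have hcd0 : ContDiffAt ℝ ∞ Ψ 0 := contDiffAt_edgeChart hO hg (by rwa [hP0])
  have hn0 : (∞ : WithTop ℕ∞) ≠ 0 := by norm_num
  set Q := (hcd0.toOpenPartialHomeomorph Ψ hder0 hn0).restrOpen G hGo with hQ
  have hQΨ : ∀ x, Q x = Ψ x := fun x => rfl
  have hQG : ∀ x ∈ Q.source, x ∈ G := fun x hx => hx.2
  have h0Q : (0 : CSpace L) ∈ Q.source :=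
    ⟨hcd0.mem_toOpenPartialHomeomorph_source hder0 hn0, h0G⟩
  have hQder : ∀ x ∈ Q.source, HasFDerivAt Q (D x) x := fun x hx =>
    hasFDerivAt_edgeChart hO hg (hG x (hQG x hx)).1
  have hQcd : ∀ x ∈ Q.source, ContDiffAt ℝ ∞ Q x := fun x hx =>
    contDiffAt_edgeChart hO hg (hG x (hQG x hx)).1
  have hQscd : ∀ a ∈ Q.target, ContDiffAt ℝ ∞ Q.symm a := fun a ha => by
    have hs := Q.map_target ha
    obtain ⟨A, hA⟩ := (hG _ (hQG _ hs)).2.2.2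
    exact Q.contDiffAt_symm ha (f₀' := A) (by rw [hA]; exact hQder _ hs) (hQcd _ hs)
  set S' := edgeSubspace θ l with hS'
  set E : Set (CSpace L) := {z | z ∈ Q.target ∧ Q.symm z ∈ S'} with hE
  have hΨE : ∀ y ∈ Q.source, y ∈ S' → Ψ y ∈ E := fun y hy hyS => by
    refine ⟨Q.map_source hy, ?_⟩
    rw [← hQΨ, Q.left_inv hy]
    exact hyS
  refine ⟨E, ⟨Module.finrank ℝ S', fun x hx => ⟨Q.symm, S', hx.1, fun a ha =>
    (hQscd a ha).contDiffWithinAt, fun a ha => (hQcd a ha).contDiffWithinAt, rfl,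
    fun z hz => ⟨fun h => h.2, fun h => ⟨hz, h⟩⟩⟩⟩, fun x hx => ?_, ?_, fun x hx => ?_, ?_⟩
  · have hy := Q.map_target hx.1
    rw [eq_top_iff, ← span_edgeChartDeriv_eq_top hθ hl hlv hθv (hG _ (hQG _ hy)).2.2.1]
    refine Submodule.span_mono ?_
    rintro _ ⟨u, hu, rfl⟩
    have hline : HasDerivAt (fun t : ℝ => Q.symm x + t • u) u 0 := by
      simpa using ((hasDerivAt_id (0 : ℝ)).smul_const u).const_add (Q.symm x)
    have hline0 : Q.symm x + (0 : ℝ) • u = Q.symm x := by simp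
    refine mem_tangentSpace_of_eventually (c := fun t : ℝ => Q (Q.symm x + t • u)) ?_ ?_ ?_
    · simp only [hline0]; exact Q.right_inv hx.1
    · have : ∀ᶠ t : ℝ in 𝓝 0, Q.symm x + t • u ∈ Q.source :=
        hline.continuousAt.eventually (by beta_reduce; rw [hline0]; exact Q.open_source.mem_nhds hy)
      filter_upwards [this] with t ht
      exact hΨE _ ht (S'.add_mem hx.2 (S'.smul_mem t hu))
    · have hd : HasFDerivAt Q (D (Q.symm x)) (Q.symm x + (0 : ℝ) • u) := by
        rw [hline0]; exact hQder _ hy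
      exact hd.comp_hasDerivAt (0 : ℝ) hline
  · have hT : ContinuousAt (fderiv ℝ g 0) 0 := (fderiv ℝ g 0).continuous.continuousAt
    have := hT.eventually (p := fun y => y ∈ Q.source)
      (by rw [map_zero]; exact Q.open_source.mem_nhds h0Q)
    filter_upwards [this] with t ht
    rw [← hΨT]
    exact hΨE _ ht (hTS t)
  · have hy := Q.map_target hx.1
    set y := Q.symm x with hydef
    refine ⟨rePart θ y, (hG _ (hQG _ hy)).2.1, y - fderiv ℝ g 0 (rePart θ y), ?_, ?_, ?_⟩
    · funext j
      rw [map_sub, Pi.sub_apply, hθ, rePart_apply]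
      refine Complex.ext ?_ ?_
      · simp
      · simpa using hx.2.1 j
    · rw [map_sub, hl, sub_zero]; exact hx.2.2
    · rw [← Q.right_inv hx.1, ← hydef, hQΨ, hΨ, edgeChart]; abel
  · intro w hw
    have hle : tangentSpace E (g 0) ≤ LinearMap.ker (Complex.reLm ∘ₗ
        (l : CSpace L →ₗ[ℂ] ℂ).restrictScalars ℝ) := by
      refine Submodule.span_le.2 ?_
      rintro w ⟨c, hc0, hcE, hcd⟩
      have hg0 : g 0 = Q 0 := by rw [hQΨ, ← hΨT 0, map_zero]
      have hgt : g 0 ∈ Q.target := by rw [hg0]; exact Q.map_source h0Q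
      have hsd : HasFDerivAt Q.symm (fderiv ℝ Q.symm (g 0)) (c 0) := by
        rw [hc0]
        exact ((hQscd _ hgt).differentiableAt hn0).hasFDerivAt
      have hyd : HasDerivAt (fun t => Q.symm (c t)) (fderiv ℝ Q.symm (g 0) w) 0 :=
        hsd.comp_hasDerivAt (0 : ℝ) hcd
      set w' := fderiv ℝ Q.symm (g 0) w with hw'
      have hy0 : Q.symm (c 0) = 0 := by rw [hc0, hg0, Q.left_inv h0Q]
      have hQd : HasFDerivAt Q (ContinuousLinearMap.id ℝ (CSpace L)) (Q.symm (c 0)) := by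
        rw [hy0]; exact hder0
      have hcomp : HasDerivAt (fun t => Q (Q.symm (c t))) w' 0 := by
        have h := hQd.comp_hasDerivAt (0 : ℝ) hyd
        rw [ContinuousLinearMap.id_apply] at h
        exact h
      have hcc : (fun t => Q (Q.symm (c t))) = c := funext fun t => Q.right_inv (hcE t).1
      rw [hcc] at hcomp
      -- The chart is tangent to the identity at the origin.
      have hww : w = w' := hcd.unique hcomp
      set ρ : CSpace L →L[ℝ] ℝ := Complex.reCLM.comp (l.restrictScalars ℝ) with hρ
      have hρd : HasDerivAt (fun t => ρ (Q.symm (c t))) (ρ w') 0 :=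
        ρ.hasFDerivAt.comp_hasDerivAt (0 : ℝ) hyd
      have hρ0 : (fun t => ρ (Q.symm (c t))) = fun _ => 0 := funext fun t => (hcE t).2.2
      rw [hρ0] at hρd
      have : ρ w' = 0 := hρd.unique (hasDerivAt_const _ _)
      rw [← hww] at this
      exact this
    exact hle hw

end Edge

/-! ### The wedge and the extension -/

section Cone

variable {L : ℕ}

/-- The open convex cone of vectors `γ` that differ from `(Re l γ) v` by less than `κ Re l γ`. -/
def directionCone (l : CSpace L →L[ℂ] ℂ) (v : CSpace L) (κ : ℝ) : Set (CSpace L) :=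
  {γ | ‖γ - (l γ).re • v‖ < κ * (l γ).re}

theorem isConicNhd_directionCone {l : CSpace L →L[ℂ] ℂ} {v : CSpace L} (hlv : l v = 1) {κ : ℝ}
    (hκ : 0 < κ) : IsConicNhd (directionCone l v κ) v := by
  refine ⟨?_, ?_, ?_, ?_⟩
  · refine isOpen_lt ?_ ?_ <;> fun_prop
  · intro x hx y hy a b ha hb hab
    simp only [directionCone, mem_ofPred_eq] at hx hy ⊢
    have hl : (l (a • x + b • y)).re = a * (l x).re + b * (l y).re := by
      rw [map_add, ← Complex.coe_smul, ← Complex.coe_smul, map_smul, map_smul]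
      simp
    have e : a • x + b • y - (a * (l x).re + b * (l y).re) • v
        = a • (x - (l x).re • v) + b • (y - (l y).re • v) := by module
    rw [hl, e]
    have h1 : ‖a • (x - (l x).re • v) + b • (y - (l y).re • v)‖
        ≤ a * ‖x - (l x).re • v‖ + b * ‖y - (l y).re • v‖ := by
      refine (norm_add_le _ _).trans (le_of_eq ?_)
      rw [norm_smul, norm_smul, Real.norm_of_nonneg ha, Real.norm_of_nonneg hb]
    refine h1.trans_lt ?_
    rcases ha.eq_or_lt with rfl | ha'
    · have hb1 : b = 1 := by linarith
      subst hb1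
      linarith
    · have h2 := mul_lt_mul_of_pos_left hx ha'
      have h3 := mul_le_mul_of_nonneg_left hy.le hb
      linarith
  · intro γ hγ c hc
    simp only [directionCone, mem_ofPred_eq] at hγ ⊢
    have hl : (l (c • γ)).re = c * (l γ).re := by
      rw [← Complex.coe_smul, map_smul]
      simp
    have e : c • γ - (c * (l γ).re) • v = c • (γ - (l γ).re • v) := by module
    rw [hl, e, norm_smul, Real.norm_of_nonneg hc.le]
    have := mul_lt_mul_of_pos_left hγ hc
    linarith
  · simp [directionCone, hlv, hκ]

theorem isOpen_wedgeSet {E V Γ : Set (CSpace L)} (hΓ : IsOpen Γ) (ε : ℝ) :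
    IsOpen (wedgeSet E V Γ ε) := by
  have e : wedgeSet E V Γ ε = ⋃ x ∈ E ∩ V, (fun z => z - x) ⁻¹' (Γ ∩ {γ | ‖γ‖ < ε}) := by
    ext z
    simp only [wedgeSet, mem_ofPred_eq, mem_iUnion, mem_preimage, exists_prop, mem_inter_iff]
    constructor
    · rintro ⟨x, hx, γ, hγ, hγε, rfl⟩
      exact ⟨x, hx, by simpa using ⟨hγ, hγε⟩⟩
    · rintro ⟨x, hx, hγ, hγε⟩
      exact ⟨x, hx, z - x, hγ, hγε, by abel⟩
  rw [e]
  refine isOpen_biUnion fun x _ => ?_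
  exact (hΓ.inter (isOpen_lt continuous_norm continuous_const)).preimage
    (continuous_id.sub continuous_const)

end Cone

end CRGeom

theorem theorem1p7 (L m : ℕ) (N : Set (CRGeom.CSpace L))
    (hN : CRGeom.IsSmoothSubmanifold m N) (hreal : CRGeom.IsTotallyReal N)
    (hgen : ¬ CRGeom.IsGeneric N)
    (p : CRGeom.CSpace L) (hp : p ∈ N)
    (v : CRGeom.CSpace L) (hv : CRGeom.IsComplexTransversal N p v)
    (U : Set (CRGeom.CSpace L)) (hU : IsOpen U) (hpU : p ∈ U)
    (f : CRGeom.CSpace L → ℂ) (hf : ContinuousOn f (N ∩ U)) :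
    ∃ W E V : Set (CRGeom.CSpace L),
      CRGeom.IsWedge W E V p v ∧ V ⊆ U ∧ N ∩ V ⊆ E ∧
        ∃ F : CRGeom.CSpace L → ℂ, CRGeom.IsHolomorphicExtension F W f (N ∩ V) := by
  obtain ⟨g, O, hO, h0, hg, hg0, hgN, hgp, hinj⟩ := hN.exists_parametrization hp
  have hgd : HasFDerivAt g (fderiv ℝ g 0) 0 :=
    ((hg.contDiffAt (hO.mem_nhds h0)).differentiableAt (by norm_num)).hasFDerivAt
  have hTN : ∀ u, fderiv ℝ g 0 u ∈ CRGeom.tangentSpace N p := fun u => by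
    have hline : HasDerivAt (fun t : ℝ => t • u) u 0 := by
      simpa using (hasDerivAt_id (0 : ℝ)).smul_const u
    have hline0 : (0 : ℝ) • u = 0 := zero_smul _ _
    refine CRGeom.mem_tangentSpace_of_eventually (c := fun t : ℝ => g (t • u)) ?_ ?_ ?_
    · simp only [hline0]; exact hg0
    · have : ∀ᶠ t : ℝ in 𝓝 0, t • u ∈ O :=
        hline.continuousAt.eventually (by beta_reduce; rw [hline0]; exact hO.mem_nhds h0)
      exact this.mono fun t ht => hgN _ ht
    · have hd : HasFDerivAt g (fderiv ℝ g 0) ((0 : ℝ) • u) := by rw [hline0]; exact hgd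
      exact hd.comp_hasDerivAt (0 : ℝ) hline
  obtain ⟨θ, l, hθ, hl, hlv, hθv⟩ := CRGeom.exists_adapted_forms hinj hTN (hreal p hp) hv
  set q : ℝ := 2 ^ (Module.finrank ℝ (EuclideanSpace ℝ (Fin m)) / 2 : ℝ) with hq
  have hq1 : 1 ≤ q := Real.one_le_rpow (by norm_num) (by positivity)
  set δ : ℝ := 1 / (16 * (q * q)) with hδ
  have hδ0 : 0 < δ := by positivity
  have hδq : δ * (16 * (q * q)) ≤ 1 := by
    rw [hδ, one_div, inv_mul_cancel₀ (by positivity)]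
  have hδ2 : δ ≤ 1 / 2 := by
    rw [hδ]
    exact one_div_le_one_div_of_le two_pos (by nlinarith)
  have hgU : g ⁻¹' U ∈ 𝓝 0 := hgd.continuousAt (by rw [hg0]; exact hU.mem_nhds hpU)
  obtain ⟨Λ, k, r, κ, hr, hκ, hsub, hΛ, hker⟩ :=
    CRGeom.exists_kernelExponent_bounds hO h0 hg hθ hl hlv hθv hδ0 hgU
  have hr2 : Metric.closedBall (0 : EuclideanSpace ℝ (Fin m)) r ⊆ Metric.closedBall 0 (2 * r) :=
    Metric.closedBall_subset_closedBall (by linarith)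
  have hgc : ContinuousOn g (Metric.closedBall 0 (2 * r)) :=
    hg.continuousOn.mono fun s hs => (hsub hs).2
  have hrn : Metric.closedBall (0 : EuclideanSpace ℝ (Fin m)) r ∈ 𝓝 0 :=
    Metric.closedBall_mem_nhds 0 hr
  obtain ⟨E, hEs, hEg, hgE, hEt, hEl⟩ := CRGeom.exists_edge hO h0 hg hθ hl hlv hθv hrn
  obtain ⟨V₀, hV₀, hV₀o, hpV₀⟩ := _root_.eventually_nhds_iff.1 (hgp _ (inter_mem hrn hgE))
  set V := V₀ ∩ U with hV
  have hNV : ∀ x ∈ N ∩ V, ∃ t ∈ Metric.closedBall (0 : EuclideanSpace ℝ (Fin m)) r,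
      g t ∈ E ∧ g t = x := fun x hx => by
    obtain ⟨t, ht, htx⟩ := hV₀ x hx.2.1 hx.1
    exact ⟨t, ht.1, ht.2, htx⟩
  set Γ := CRGeom.directionCone l v κ with hΓ
  have hΓc := CRGeom.isConicNhd_directionCone hlv hκ
  set b := CRGeom.kernelExponent g θ Λ k with hb
  have hdom : ∀ t ∈ Metric.closedBall (0 : EuclideanSpace ℝ (Fin m)) r,
      ∀ s ∈ Metric.closedBall (0 : EuclideanSpace ℝ (Fin m)) (2 * r),
        ‖t - s‖ ^ 2 / 2 ≤ (b (g t) s).re := fun t ht s hs => by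
    have h := (abs_le.1 ((Complex.abs_re_le_norm _).trans (hker t (hr2 ht) s hs).1)).1
    rw [Complex.sub_re, Complex.ofReal_re] at h
    have : δ * ‖t - s‖ ^ 2 ≤ 1 / 2 * ‖t - s‖ ^ 2 := by gcongr
    linarith
  have hWD : CRGeom.wedgeSet E V Γ 1 ⊆ CRGeom.dominationRegion b r := by
    rintro z ⟨x, hx, γ, hγ, hγ1, rfl⟩
    obtain ⟨t, ht, h, hθh, hlh, rfl⟩ := hEt x hx.1
    exact ⟨t, ht, fun s hs => (hdom t ht s hs).trans
      ((hker t (hr2 ht) s hs).2 h γ hθh hlh (le_of_lt hγ) hγ1.le)⟩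
  obtain ⟨F, hFc, hFd, hFg⟩ := CRGeom.exists_extension_of_kernel (n := g) (φ := fun t => f (g t))
    hr hδ0.le hδq (CRGeom.continuousOn_kernelExponent hgc hΛ k)
    (CRGeom.continuousOn_kernelExponentDeriv hgc hΛ k)
    (fun z s _ => CRGeom.hasFDerivAt_kernelExponent k z s) (hgc.mono hr2)
    (fun t ht s hs => (hker t (hr2 ht) s hs).1)
    (hf.comp (hgc.mono hr2) fun t ht => ⟨hgN t (hsub (hr2 ht)).2, (hsub (hr2 ht)).1⟩)
  refine ⟨CRGeom.wedgeSet E V Γ 1, E, V, ⟨hEs, hEg, ?_, hV₀o.inter hU, ⟨hpV₀, hpU⟩, Γ, 1, hΓc, ?_,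
    one_pos, rfl⟩, inter_subset_right, fun x hx => ?_, F, ?_, fun x hx => ?_⟩
  · rw [← hg0]; exact hgE.self_of_nhds
  · rw [Set.disjoint_left]
    intro γ hγ hγE
    rw [← hg0] at hγE
    have h1 : ‖γ - (l γ).re • v‖ < κ * (l γ).re := hγ
    rw [hEl γ hγE, mul_zero] at h1
    exact absurd h1 (not_lt.2 (norm_nonneg _))
  · obtain ⟨t, -, htE, rfl⟩ := hNV x hx
    exact htE
  · exact hFd.mono (interior_maximal hWD (CRGeom.isOpen_wedgeSet hΓc.1 1))
  · obtain ⟨t, ht, -, rfl⟩ := hNV x hx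
    have h := (hFc (g t) ⟨t, ht, hdom t ht⟩).mono hWD
    rw [ContinuousWithinAt, hFg t ht] at h
    exact h
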